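/- Let $\Sigma\subset\mathbb{R}^2$ be a domain with coordinates $(u,v)$ and let $f\colon\Sigma\to\mathbb{R}^3$ be a front with unit normal vector field $\nu$: $f$ and $\nu\colon\Sigma\to\mathbb{S}^2$ are $C^\infty$, $\nu$ is orthogonal to the image of $df$, and $(f,\nu)\colon\Sigma\to\mathbb{R}^3\times\mathbb{S}^2$ is an immersion. Let $p\in\Sigma$ be a non-degenerate singular point of $f$: $df_p$ is not injective and $d\lambda(p)\neq 0$, where $\lambda=\det(f_u,f_v,\nu)$. Suppose that the Gaussian curvature $K$ of $f$, defined at the regular points of $f$, is bounded on the regular points in some neighbourhood of $p$. Terminology. A singular curve through $p$ is a regular $C^\infty$ curve $\gamma$ in $\Sigma$ with $\gamma(0)=p$ and $\lambda\circ\gamma=0$; a null vector field is a nowhere vanishing $C^\infty$ vector field $\eta$ on a neighbourhood of $p$ in $\Sigma$ with $df_q(\eta_q)=0$ at every singular point $q$ in this neighbourhood. The point $p$ is of the second kind if $\gamma'(0)$ and $\eta_p$ are linearly dependent. It is a cuspidal edge if the germ of $f$ at $p$ is carried to the germ of $(u,v)\mapsto(u,v^2,v^3)$ at the origin by diffeomorphism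 germs of the source and the target. The point $p$ is a sub-parabolic point of $f$ if there are an open neighbourhood $U\subset\Sigma$ of $p$, a $C^\infty$ function $\kappa$ on $U$, a function $\tilde\kappa$ on the regular points of $U$ and a nowhere vanishing $C^\infty$ vector field $\widetilde{V}$ on $U$ such that, at the regular points of $U$, $\kappa$ and $\tilde\kappa$ are the two principal curvatures of $f$ and $\widetilde{V}$ is a principal vector for $\tilde\kappa$; $\tilde\kappa$ is unbounded on every neighbourhood of $p$; and the directional derivative $\widetilde{V}\kappa$ vanishes at $p$. Then the following hold. 1. If $p$ is a cuspidal edge, then the limit $K(p)$ of $K(q)$, as the regular point $q$ tends to $p$, exists, and $p$ is a sub-parabolic point of $f$ if and only if $K(p)=0$. 2. If $p$ is of the second kind, then $p$ is a sub-parabolic point of $f$. -/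

import Mathlib

open Set Filter Topology
open scoped ContDiff

noncomputable section

namespace FrontGeometry

/-- The `(u, v)`-plane. -/
abbrev Plane : Type := ℝ × ℝ

/-- Euclidean three-space. -/
abbrev Space : Type := EuclideanSpace ℝ (Fin 3)

/-- The partial derivative `g_u` of a map on the plane. -/
def partialU (g : Plane → Space) (q : Plane) : Space := fderiv ℝ g q (1, 0)

/-- The partial derivative `g_v` of a map on the plane. -/
def partialV (g : Plane → Space) (q : Plane) : Space := fderiv ℝ g q (0, 1)

/-- The `C^∞` map `f` on the domain `Σ = D` is a front with unit normal vector field `ν`: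
`ν` is a `C^∞` map into the unit sphere, orthogonal to the image of `df`, and `(f, ν)` is an
immersion. -/
structure IsFront (D : Set Plane) (f ν : Plane → Space) : Prop where
  smooth : ContDiffOn ℝ ∞ f D
  smooth_normal : ContDiffOn ℝ ∞ ν D
  norm_normal : ∀ q ∈ D, ‖ν q‖ = 1
  orthogonal : ∀ q ∈ D, ∀ X : Plane, inner ℝ (fderiv ℝ f q X) (ν q) = 0
  immersion : ∀ q ∈ D, Function.Injective (fderiv ℝ (fun x => (f x, ν x)) q)

/-- The set of regular points of `f` in `D`, where `f` is an immersion. -/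
def regularSet (D : Set Plane) (f : Plane → Space) : Set Plane :=
  {q | q ∈ D ∧ Function.Injective (fderiv ℝ f q)}

/-- The set `S(f)` of singular points of `f` in `D`. -/
def singularSet (D : Set Plane) (f : Plane → Space) : Set Plane :=
  {q | q ∈ D ∧ ¬ Function.Injective (fderiv ℝ f q)}

/-- The signed area density function `λ = det (f_u, f_v, ν)`. -/
def areaDensity (f ν : Plane → Space) (q : Plane) : ℝ :=
  Matrix.det (Matrix.of fun i j : Fin 3 => (![partialU f q, partialV f q, ν q] i) j)

/-- A singular point `p` is non-degenerate if `dλ(p) ≠ 0`. -/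
def IsNondegenerateSingular (D : Set Plane) (f ν : Plane → Space) (p : Plane) : Prop :=
  p ∈ singularSet D f ∧ fderiv ℝ (areaDensity f ν) p ≠ 0

/-- `γ`, restricted to `(-ε, ε)`, is a singular curve through `p`: a regular `C^∞` curve in `D`
with `γ 0 = p` on which `λ` vanishes. -/
structure IsSingularCurve (D : Set Plane) (f ν : Plane → Space) (p : Plane)
    (ε : ℝ) (γ : ℝ → Plane) : Prop where
  pos : 0 < ε
  smooth : ContDiffOn ℝ ∞ γ (Ioo (-ε) ε)
  regular : ∀ t ∈ Ioo (-ε) ε, deriv γ t ≠ 0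
  start : γ 0 = p
  mem : ∀ t ∈ Ioo (-ε) ε, γ t ∈ D
  density_eq_zero : ∀ t ∈ Ioo (-ε) ε, areaDensity f ν (γ t) = 0

/-- `η` is a null vector field on the open neighbourhood `U ⊆ D` of `p`: it is `C^∞`, never zero,
and `df_q(η_q) = 0` at every singular point `q ∈ U`. -/
structure IsNullVectorField (D : Set Plane) (f : Plane → Space) (p : Plane)
    (U : Set Plane) (η : Plane → Plane) : Prop where
  isOpen : IsOpen U
  mem : p ∈ U
  subset : U ⊆ D
  smooth : ContDiffOn ℝ ∞ η U
  ne_zero : ∀ q ∈ U, η q ≠ 0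
  null : ∀ q ∈ singularSet D f ∩ U, fderiv ℝ f q (η q) = 0

/-- A non-degenerate singular point is of the second kind if the velocity of the singular curve
and the null vector are linearly dependent there. (Both are unique up to non-zero factors.) -/
def IsOfSecondKind (D : Set Plane) (f ν : Plane → Space) (p : Plane) : Prop :=
  IsNondegenerateSingular D f ν p ∧
    ∃ (ε : ℝ) (γ : ℝ → Plane) (U : Set Plane) (η : Plane → Plane),
      IsSingularCurve D f ν p ε γ ∧ IsNullVectorField D f p U η ∧
        ¬ LinearIndependent ℝ ![deriv γ 0, η p]

/-- `𝒜`-equivalence of the germ of `f₁` at `p₁` and the germ of `f₂` at `p₂`: there are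
diffeomorphism germs `φ` of the source and `Φ` of the target with `Φ ∘ f₁ = f₂ ∘ φ` near `p₁`. -/
def AEquivalent (f₁ : Plane → Space) (p₁ : Plane) (f₂ : Plane → Space) (p₂ : Plane) : Prop :=
  ∃ (φ : OpenPartialHomeomorph Plane Plane) (Φ : OpenPartialHomeomorph Space Space),
    p₁ ∈ φ.source ∧ φ p₁ = p₂ ∧
    ContDiffOn ℝ ∞ φ φ.source ∧ ContDiffOn ℝ ∞ φ.symm φ.target ∧
    f₁ p₁ ∈ Φ.source ∧ Φ (f₁ p₁) = f₂ p₂ ∧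
    ContDiffOn ℝ ∞ Φ Φ.source ∧ ContDiffOn ℝ ∞ Φ.symm Φ.target ∧
    ∀ᶠ q in 𝓝 p₁, Φ (f₁ q) = f₂ (φ q)

/-- The standard cuspidal edge `(u, v) ↦ (u, v², v³)`. -/
def standardCuspidalEdge (q : Plane) : Space := !₂[q.1, q.2 ^ 2, q.2 ^ 3]

/-- `f` is a cuspidal edge at `p`. -/
def IsCuspidalEdge (f : Plane → Space) (p : Plane) : Prop :=
  AEquivalent f p standardCuspidalEdge 0

/-- The matrix of the first fundamental form. -/
def firstForm (f : Plane → Space) (q : Plane) : Matrix (Fin 2) (Fin 2) ℝ :=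
  !![inner ℝ (partialU f q) (partialU f q), inner ℝ (partialU f q) (partialV f q);
     inner ℝ (partialU f q) (partialV f q), inner ℝ (partialV f q) (partialV f q)]

/-- The matrix of the second fundamental form. -/
def secondForm (f ν : Plane → Space) (q : Plane) : Matrix (Fin 2) (Fin 2) ℝ :=
  !![-inner ℝ (partialU f q) (partialU ν q), -inner ℝ (partialU f q) (partialV ν q);
     -inner ℝ (partialV f q) (partialU ν q), -inner ℝ (partialV f q) (partialV ν q)]

/-- The Gaussian curvature `K = (LN - M²) / (EG - F²)`, meaningful at regular points only. -/
def gaussCurvature (f ν : Plane → Space) (q : Plane) : ℝ :=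
  (secondForm f ν q).det / (firstForm f q).det

/-- The mean curvature `H = (EN - 2FM + GL) / (2 (EG - F²))`, meaningful at regular points only. -/
def meanCurvature (f ν : Plane → Space) (q : Plane) : ℝ :=
  (firstForm f q 0 0 * secondForm f ν q 1 1
      - firstForm f q 0 1 * (secondForm f ν q 0 1 + secondForm f ν q 1 0)
      + firstForm f q 1 1 * secondForm f ν q 0 0) / (2 * (firstForm f q).det)

/-- On the regular points of `U`, the functions `κ` and `κ'` are the two principal curvatures
(with multiplicity): `κ κ' = K` and `κ + κ' = 2H`. -/
def ArePrincipalCurvatures (D : Set Plane) (f ν : Plane → Space) (U : Set Plane)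
    (κ κ' : Plane → ℝ) : Prop :=
  ∀ q ∈ regularSet D f ∩ U,
    κ q * κ' q = gaussCurvature f ν q ∧ κ q + κ' q = 2 * meanCurvature f ν q

/-- `g`, defined on the regular points of `f`, is bounded near `p`. -/
def IsBoundedNear (D : Set Plane) (f : Plane → Space) (p : Plane) (g : Plane → ℝ) : Prop :=
  ∃ U : Set Plane, IsOpen U ∧ p ∈ U ∧ ∃ C : ℝ, ∀ q ∈ regularSet D f ∩ U, |g q| ≤ C

/-- `V` is a principal vector field on `U` for the principal curvature `k`: it is `C^∞`, never
zero on `U` (singular points included), and `(II - k I) V = 0` at the regular points of `U`. -/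
structure IsPrincipalVectorField (D : Set Plane) (f ν : Plane → Space) (U : Set Plane)
    (k : Plane → ℝ) (V : Plane → Plane) : Prop where
  smooth : ContDiffOn ℝ ∞ V U
  ne_zero : ∀ q ∈ U, V q ≠ 0
  principal : ∀ q ∈ regularSet D f ∩ U,
    Matrix.mulVec (secondForm f ν q - k q • firstForm f q) ![(V q).1, (V q).2] = 0

/-- `p` is a sub-parabolic point: near `p`, one principal curvature extends to a `C^∞` function `κ`
(the bounded one), the other one, `κ'`, is unbounded, and the derivative of `κ` at `p` in the
direction of a principal vector field of `κ'` vanishes. -/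
def IsSubparabolic (D : Set Plane) (f ν : Plane → Space) (p : Plane) : Prop :=
  ∃ (U : Set Plane) (κ κ' : Plane → ℝ) (V' : Plane → Plane),
    IsOpen U ∧ p ∈ U ∧ U ⊆ D ∧
    ContDiffOn ℝ ∞ κ U ∧
    ArePrincipalCurvatures D f ν U κ κ' ∧
    ¬ IsBoundedNear D f p κ' ∧
    IsPrincipalVectorField D f ν U κ' V' ∧
    fderiv ℝ κ p (V' p) = 0

end FrontGeometry

end

open FrontGeometry

/-! Near `p` there is a frame `a`, `η` with `a` constant, `df(η) = λ h`, `h` nowhere zero and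
`df(a)` orthogonal to `h`; so `η` spans the kernel of `df` wherever `λ = 0`. In this frame the first
form is diagonal with entries `E`, `λ² G`, and the second has entries `L`, `λ M`, `λ M`, `λ N`,
where `E, G > 0`, and `N ≠ 0` because `(f, ν)` is an immersion. Once powers of `λ` are cleared, the
characteristic equation has positive discriminant at `p`. Hence one principal curvature is a smooth
function `κ`, the other is `ρ / λ` with `ρ` smooth and nonvanishing, and the principal direction of
the latter extends smoothly to `p`, where it is the direction of `η p` (`exists_isCurvatureData`).
Every choice allowed in the definition of a sub-parabolic point yields the same `κ` near `p` and the
same direction at `p`, so `p` is sub-parabolic iff `dκ(η) = 0` there (`isSubparabolic_iff`).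

Since `K = κ ρ / λ` is bounded, `κ` vanishes on the singular set. As `dλ ≠ 0` at `p`, this gives `κ
= c λ + o(λ)` and `dκ = c dλ` at `p` (`exists_isLittleO_of_vanishing`). Therefore `K` tends to `c
ρ(p)`, and sub-parabolicity reads `c dλ(η) = 0`.

At a cuspidal edge the null direction is transversal to the singular curve, so `dλ(η) ≠ 0` and both
conditions say `c = 0`. At a point of the second kind it is tangent, so `dλ(η) = 0` whatever `c` is.
-/

namespace FrontGeometry

/-! ### Functions vanishing on a regular level set. -/

section Analysis

variable {E : Type*} [NormedAddCommGroup E] [NormedSpace ℝ E]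

/-- Near a non-critical zero `p` of `g`, every point is within `O(|g|)` of the zero set. -/
theorem exists_zero_near {g : E → ℝ} {g' : E →L[ℝ] ℝ} {p : E}
    (hg : HasStrictFDerivAt g g' p) (hgc : ∀ᶠ q in 𝓝 p, ContinuousAt g q) (hp : g p = 0)
    {w : E} (hw : g' w = 1) :
    ∀ᶠ q in 𝓝 p, ∃ t : ℝ, |t| ≤ 2 * |g q| ∧ g (q + t • w) = 0 := by
  have hw0 : 0 < ‖w‖ := norm_pos_iff.2 (by rintro rfl; simp at hw)
  -- With this constant the linearization error along `t • w` is at most `|t| / 2`.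
  have hlo := hg.isLittleO.bound (c := 1 / (2 * ‖w‖)) (by positivity)
  rw [Metric.eventually_nhds_iff] at hlo hgc
  obtain ⟨r, hr, hlo⟩ := hlo
  obtain ⟨r', hr', hgc⟩ := hgc
  have hgp : ContinuousAt g p := hg.continuousAt
  have h1 : ∀ᶠ q in 𝓝 p, |g q| < min r r' / (8 * ‖w‖) := by
    have : Tendsto (fun q => |g q|) (𝓝 p) (𝓝 0) := by simpa [hp] using hgp.abs.tendsto
    exact this.eventually_lt_const (by positivity)
  have h2 : ∀ᶠ q in 𝓝 p, dist q p < min r r' / 2 := Metric.ball_mem_nhds p (by positivity)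
  filter_upwards [h1, h2] with q hq1 hq2
  have key : ∀ t : ℝ, |t| ≤ 2 * |g q| → dist (q + t • w) p < min r r' := by
    intro t ht
    have h3 : ‖t • w‖ ≤ min r r' / 4 := by
      rw [norm_smul, Real.norm_eq_abs]
      calc |t| * ‖w‖ ≤ 2 * (min r r' / (8 * ‖w‖)) * ‖w‖ := by gcongr; linarith
        _ = min r r' / 4 := by field_simp; ring
    have hm : 0 < min r r' := by positivity
    calc dist (q + t • w) p ≤ dist (q + t • w) q + dist q p := dist_triangle _ _ _
      _ < min r r' := by rw [dist_self_add_left]; linarith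
  have est : ∀ t : ℝ, |t| ≤ 2 * |g q| → |g (q + t • w) - g q - t| ≤ |t| / 2 := by
    intro t ht
    have hd : dist ((q + t • w, q) : E × E) (p, p) < r := by
      rw [Prod.dist_eq]
      have ha := key t ht
      have hm : 0 < min r r' := by positivity
      have := min_le_left r r'
      exact max_lt (by simp only; linarith) (by simp only; linarith)
    have := hlo hd
    simp only [add_sub_cancel_left, map_smul, hw, smul_eq_mul, mul_one, norm_smul,
      Real.norm_eq_abs] at this
    calc _ ≤ _ := this
      _ = |t| / 2 := by field_simp
  have hcont : ContinuousOn (fun t : ℝ => g (q + t • w)) (Icc (-(2 * |g q|)) (2 * |g q|)) := by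
    intro t ht
    apply ContinuousAt.continuousWithinAt
    have h4 : ContinuousAt g (q + t • w) :=
      hgc ((key t (abs_le.2 ht)).trans_le (min_le_right _ _))
    exact ContinuousAt.comp (f := fun t : ℝ => q + t • w) h4 (by fun_prop)
  have ha : |(2 * |g q| : ℝ)| = 2 * |g q| := abs_of_nonneg (by positivity)
  -- At `t = ± 2 |g q|` the increment of `g` has the sign of `t` and size at least `|g q|`, so `0`
  -- lies between the two end values.
  have e1 := abs_le.1 (est (2 * |g q|) ha.le)
  have e2 := abs_le.1 (est (-(2 * |g q|)) (by rw [abs_neg, ha]))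
  rw [abs_neg] at e2
  rw [ha] at e1 e2
  have hle : -(2 * |g q|) ≤ 2 * |g q| := by linarith [abs_nonneg (g q)]
  have h5 := neg_abs_le (g q)
  have h6 := le_abs_self (g q)
  obtain ⟨t, ht, ht0⟩ := intermediate_value_Icc hle hcont
    (show (0 : ℝ) ∈ Icc _ _ from ⟨by linarith [e2.2], by linarith [e1.1]⟩)
  exact ⟨t, abs_le.2 ht, ht0⟩

/-- If `k` vanishes where `g` does, and `p` is a non-critical zero of `g`, then
`k = c g + o(g)` at `p`, and `dk = c dg` at `p`. -/
theorem exists_isLittleO_of_vanishing [CompleteSpace E] {g k : E → ℝ} {g' k' : E →L[ℝ] ℝ} {p : E}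
    (hg : HasStrictFDerivAt g g' p) (hgc : ∀ᶠ q in 𝓝 p, ContinuousAt g q) (hp : g p = 0)
    (hg' : g' ≠ 0) (hk : HasStrictFDerivAt k k' p) (h0 : ∀ᶠ q in 𝓝 p, g q = 0 → k q = 0) :
    ∃ c : ℝ, k' = c • g' ∧ (fun q => k q - c * g q) =o[𝓝 p] g := by
  -- `k` is constant on the level set, so the Lagrange multiplier rule applies; the multiplier of
  -- `k'` is nonzero because `g' ≠ 0`.
  have hext : IsLocalExtrOn k {x | g x = g p} p := by
    left
    have : ∀ᶠ q in 𝓝[{x | g x = g p}] p, k p ≤ k q := by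
      rw [eventually_nhdsWithin_iff]
      filter_upwards [h0] with q hq hqs
      rw [hq (by simpa [hp] using hqs), h0.self_of_nhds hp]
    exact this
  obtain ⟨a, b, hab, hlin⟩ := hext.exists_multipliers_of_hasStrictFDerivAt_1d hg hk
  have hb : b ≠ 0 := by
    rintro rfl
    simp only [zero_smul, add_zero, smul_eq_zero] at hlin
    rcases hlin with rfl | h
    · exact hab rfl
    · exact hg' h
  have hc : k' = (-a / b) • g' := by
    have : b • k' = (-a) • g' := by
      rw [neg_smul a g']; exact eq_neg_of_add_eq_zero_right hlin
    rw [div_eq_inv_mul, mul_smul, ← this, smul_smul, inv_mul_cancel₀ hb, one_smul]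
  refine ⟨-a / b, hc, ?_⟩
  set c := -a / b
  obtain ⟨w₀, hw₀⟩ : ∃ w, g' w ≠ 0 := by
    by_contra! h
    exact hg' (ContinuousLinearMap.ext h)
  obtain ⟨w, hw⟩ : ∃ w, g' w = 1 := ⟨(g' w₀)⁻¹ • w₀, by simp [hw₀]⟩
  have hw0 : 0 < ‖w‖ := norm_pos_iff.2 (by rintro rfl; simp at hw)
  -- `k - c g` has strict derivative zero and vanishes at the nearby zero `q + t • w` of `g`, so its
  -- value at `q` is small compared with `|t|`, hence with `|g q|`.
  have hd : HasStrictFDerivAt (fun q => k q - c * g q) (0 : E →L[ℝ] ℝ) p := by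
    have := hk.sub (hg.const_mul c)
    rwa [hc, sub_self] at this
  rw [Asymptotics.isLittleO_iff]
  intro ε hε
  have hlo := hd.isLittleO.bound (c := ε / (2 * ‖w‖)) (by positivity)
  rw [Metric.eventually_nhds_iff] at hlo h0
  obtain ⟨r, hr, hlo⟩ := hlo
  obtain ⟨r', hr', h0⟩ := h0
  have h1 : ∀ᶠ q in 𝓝 p, |g q| < min r r' / (8 * ‖w‖) := by
    have : Tendsto (fun q => |g q|) (𝓝 p) (𝓝 0) := by
      simpa [hp] using hg.continuousAt.abs.tendsto
    exact this.eventually_lt_const (by positivity)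
  have h2 : ∀ᶠ q in 𝓝 p, dist q p < min r r' / 2 := Metric.ball_mem_nhds p (by positivity)
  filter_upwards [exists_zero_near hg hgc hp hw, h1, h2] with q ⟨t, ht, htz⟩ hq1 hq2
  have hm : 0 < min r r' := by positivity
  have h3 : ‖t • w‖ ≤ min r r' / 4 := by
    rw [norm_smul, Real.norm_eq_abs]
    calc |t| * ‖w‖ ≤ 2 * (min r r' / (8 * ‖w‖)) * ‖w‖ := by gcongr; linarith
      _ = min r r' / 4 := by field_simp; ring
  have h4 : dist (q + t • w) p < min r r' := by
    calc dist (q + t • w) p ≤ dist (q + t • w) q + dist q p := dist_triangle _ _ _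
      _ < min r r' := by rw [dist_self_add_left]; linarith
  have hkz : k (q + t • w) = 0 := h0 (h4.trans_le (min_le_right _ _)) htz
  have hdd : dist ((q + t • w, q) : E × E) (p, p) < r := by
    rw [Prod.dist_eq]
    have := min_le_left r r'
    exact max_lt (by simp only; linarith) (by simp only; linarith)
  have := hlo hdd
  simp only [hkz, htz, mul_zero, sub_zero, zero_sub, zero_apply,
    add_sub_cancel_left, norm_neg, norm_smul] at this
  rw [Real.norm_eq_abs t] at this
  calc _ ≤ _ := this
    _ ≤ ε / (2 * ‖w‖) * ((2 * |g q|) * ‖w‖) := by gcongr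
    _ = ε * ‖g q‖ := by rw [Real.norm_eq_abs]; field_simp

/-- A non-critical zero is a limit of points where the function does not vanish. -/
theorem frequently_ne_zero_of_fderiv_ne_zero {g : E → ℝ} {q : E} (h : fderiv ℝ g q ≠ 0) :
    ∃ᶠ x in 𝓝 q, g x ≠ 0 := by
  intro hz
  apply h
  have : g =ᶠ[𝓝 q] fun _ => (0 : ℝ) := by
    filter_upwards [hz] with x hx
    exact not_not.1 hx
  rw [this.fderiv_eq]
  simp

end Analysis

/-! ### The cross product in space. -/

section Cross

/-- The cross product of two vectors in space. -/
noncomputable def cross (x y : Space) : Space :=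
  !₂[x 1 * y 2 - x 2 * y 1, x 2 * y 0 - x 0 * y 2, x 0 * y 1 - x 1 * y 0]

theorem inner_eq_sum (x y : Space) : inner ℝ x y = x 0 * y 0 + x 1 * y 1 + x 2 * y 2 := by
  simp only [PiLp.inner_apply, Fin.sum_univ_three, RCLike.inner_apply, conj_trivial]
  ring

theorem inner_cross_self_right (x y : Space) : inner ℝ y (cross x y) = 0 := by
  simp [inner_eq_sum, cross]; ring

theorem inner_cross_cross (x y : Space) :
    inner ℝ (cross x y) (cross x y) = inner ℝ x x * inner ℝ y y - inner ℝ x y ^ 2 := by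
  simp only [inner_eq_sum]; simp [cross]; ring

/-- A vector orthogonal to `x` and to `y` is a multiple of `x × y`. -/
theorem smul_eq_inner_smul_cross {x y w : Space} (hx : inner ℝ w x = 0) (hy : inner ℝ w y = 0) :
    inner ℝ (cross x y) (cross x y) • w = inner ℝ w (cross x y) • cross x y := by
  rw [inner_eq_sum] at hx hy
  ext i
  simp only [inner_eq_sum, PiLp.smul_apply, smul_eq_mul]
  fin_cases i <;> simp [cross]
  · linear_combination (-(x 0 * (y 0^2+y 1^2+y 2^2)) + y 0 * (x 0 * y 0 + x 1 * y 1 + x 2 * y 2)) * (-1) * hx + (-(y 0 * (x 0^2+x 1^2+x 2^2)) + x 0 * (x 0 * y 0 + x 1 * y 1 + x 2 * y 2)) * (-1) * hy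
  · linear_combination (-(x 1 * (y 0^2+y 1^2+y 2^2)) + y 1 * (x 0 * y 0 + x 1 * y 1 + x 2 * y 2)) * (-1) * hx + (-(y 1 * (x 0^2+x 1^2+x 2^2)) + x 1 * (x 0 * y 0 + x 1 * y 1 + x 2 * y 2)) * (-1) * hy
  · linear_combination (-(x 2 * (y 0^2+y 1^2+y 2^2)) + y 2 * (x 0 * y 0 + x 1 * y 1 + x 2 * y 2)) * (-1) * hx + (-(y 2 * (x 0^2+x 1^2+x 2^2)) + x 2 * (x 0 * y 0 + x 1 * y 1 + x 2 * y 2)) * (-1) * hy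

theorem _root_.ContDiffOn.frontCross {s : Set Plane} {x y : Plane → Space}
    (hx : ContDiffOn ℝ ∞ x s) (hy : ContDiffOn ℝ ∞ y s) :
    ContDiffOn ℝ ∞ (fun q => cross (x q) (y q)) s := by
  rw [contDiffOn_euclidean] at hx hy ⊢
  intro i
  fin_cases i
  · exact ((hx 1).mul (hy 2)).sub ((hx 2).mul (hy 1))
  · exact ((hx 2).mul (hy 0)).sub ((hx 0).mul (hy 2))
  · exact ((hx 0).mul (hy 1)).sub ((hx 1).mul (hy 0))

end Cross

/-! ### Fundamental forms and curvatures in an arbitrary basis. -/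

section Plane

/-- The determinant of two vectors of the plane. -/
noncomputable def planeDet (X Y : Plane) : ℝ := X.1 * Y.2 - X.2 * Y.1

/-- Cramer's rule with the denominator cleared. -/
theorem planeDet_smul_eq (X Y Z : Plane) :
    planeDet X Y • Z = planeDet Z Y • X + planeDet X Z • Y := by
  ext <;> simp [planeDet] <;> ring

theorem fderiv_apply_eq (g : Plane → Space) (q X : Plane) :
    fderiv ℝ g q X = X.1 • partialU g q + X.2 • partialV g q := by
  rw [partialU, partialV, ← map_smul, ← map_smul, ← map_add]
  congr 1
  ext <;> simp

theorem areaDensity_eq (f ν : Plane → Space) (q : Plane) :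
    areaDensity f ν q = inner ℝ (partialV f q) (cross (ν q) (partialU f q)) := by
  simp [areaDensity, Matrix.det_fin_three, inner_eq_sum, cross]
  ring

/-- The left side is the triple product `det (df X, df Y, ν)`, which is alternating and bilinear in
`X`, `Y`. -/
theorem inner_fderiv_cross (f ν : Plane → Space) (q X Y : Plane) :
    inner ℝ (fderiv ℝ f q Y) (cross (ν q) (fderiv ℝ f q X)) =
      planeDet X Y * areaDensity f ν q := by
  rw [areaDensity_eq, fderiv_apply_eq, fderiv_apply_eq]
  simp [inner_eq_sum, cross, planeDet]
  ring

/-- The second fundamental form as a bilinear form. -/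
noncomputable def second (f ν : Plane → Space) (q X Y : Plane) : ℝ :=
  -inner ℝ (fderiv ℝ f q X) (fderiv ℝ ν q Y)

/-- The first fundamental form as a bilinear form. -/
noncomputable def first (f : Plane → Space) (q X Y : Plane) : ℝ :=
  inner ℝ (fderiv ℝ f q X) (fderiv ℝ f q Y)

theorem second_eq (f ν : Plane → Space) (q X Y : Plane) :
    second f ν q X Y = X.1 * Y.1 * secondForm f ν q 0 0 + X.1 * Y.2 * secondForm f ν q 0 1 +
      X.2 * Y.1 * secondForm f ν q 1 0 + X.2 * Y.2 * secondForm f ν q 1 1 := by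
  rw [second, fderiv_apply_eq, fderiv_apply_eq]
  simp [secondForm, inner_add_left, inner_add_right, inner_smul_left, inner_smul_right]
  ring

theorem first_eq (f : Plane → Space) (q X Y : Plane) :
    first f q X Y = X.1 * Y.1 * firstForm f q 0 0 + X.1 * Y.2 * firstForm f q 0 1 +
      X.2 * Y.1 * firstForm f q 0 1 + X.2 * Y.2 * firstForm f q 1 1 := by
  rw [first, fderiv_apply_eq, fderiv_apply_eq]
  simp [firstForm, inner_add_left, inner_add_right, inner_smul_left, inner_smul_right]
  rw [real_inner_comm (partialU f q) (partialV f q)]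
  ring

theorem firstForm_one_zero (f : Plane → Space) (q : Plane) :
    firstForm f q 1 0 = firstForm f q 0 1 := by simp [firstForm]

theorem gaussCurvature_eq (f ν : Plane → Space) (q : Plane) {X Y : Plane}
    (h : planeDet X Y ≠ 0) :
    gaussCurvature f ν q =
      (second f ν q X X * second f ν q Y Y - second f ν q X Y * second f ν q Y X) /
        (first f q X X * first f q Y Y - first f q X Y ^ 2) := by
  have h1 : second f ν q X X * second f ν q Y Y - second f ν q X Y * second f ν q Y X =
      planeDet X Y ^ 2 * (secondForm f ν q).det := by
    simp only [second_eq, Matrix.det_fin_two, planeDet]; ring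
  have h2 : first f q X X * first f q Y Y - first f q X Y ^ 2 =
      planeDet X Y ^ 2 * (firstForm f q).det := by
    simp only [first_eq, Matrix.det_fin_two, planeDet, firstForm_one_zero]; ring
  rw [h1, h2, gaussCurvature, mul_div_mul_left _ _ (pow_ne_zero 2 h)]

theorem two_mul_meanCurvature_eq (f ν : Plane → Space) (q : Plane) {X Y : Plane}
    (h : planeDet X Y ≠ 0) :
    2 * meanCurvature f ν q =
      (first f q X X * second f ν q Y Y -
        first f q X Y * (second f ν q X Y + second f ν q Y X) +
          first f q Y Y * second f ν q X X) /
        (first f q X X * first f q Y Y - first f q X Y ^ 2) := by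
  have h1 : first f q X X * second f ν q Y Y -
        first f q X Y * (second f ν q X Y + second f ν q Y X) +
          first f q Y Y * second f ν q X X =
      planeDet X Y ^ 2 * (firstForm f q 0 0 * secondForm f ν q 1 1
      - firstForm f q 0 1 * (secondForm f ν q 0 1 + secondForm f ν q 1 0)
      + firstForm f q 1 1 * secondForm f ν q 0 0) := by
    simp only [second_eq, first_eq, planeDet]; ring
  have h2 : first f q X X * first f q Y Y - first f q X Y ^ 2 =
      planeDet X Y ^ 2 * (firstForm f q).det := by
    simp only [first_eq, Matrix.det_fin_two, planeDet, firstForm_one_zero]; ring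
  rw [h1, h2, meanCurvature, mul_div_mul_left _ _ (pow_ne_zero 2 h), mul_div_assoc',
    mul_div_mul_left _ _ two_ne_zero]

/-- The equation of principal vectors, tested on a basis `X`, `Y`. -/
theorem principal_iff (f ν : Plane → Space) (q V : Plane) (k : ℝ) {X Y : Plane}
    (h : planeDet X Y ≠ 0) :
    Matrix.mulVec (secondForm f ν q - k • firstForm f q) ![V.1, V.2] = 0 ↔
      second f ν q X V = k * first f q X V ∧ second f ν q Y V = k * first f q Y V := by
  set A := (secondForm f ν q 0 0 - k * firstForm f q 0 0) * V.1 +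
    (secondForm f ν q 0 1 - k * firstForm f q 0 1) * V.2 with hA
  set B := (secondForm f ν q 1 0 - k * firstForm f q 0 1) * V.1 +
    (secondForm f ν q 1 1 - k * firstForm f q 1 1) * V.2 with hB
  have h0 : Matrix.mulVec (secondForm f ν q - k • firstForm f q) ![V.1, V.2] = ![A, B] := by
    ext i
    fin_cases i <;>
      simp [Matrix.mulVec, dotProduct, Fin.sum_univ_two, hA, hB, firstForm_one_zero]
  have hX : ∀ X : Plane, second f ν q X V = k * first f q X V ↔ X.1 * A + X.2 * B = 0 := by
    intro X
    rw [second_eq, first_eq, hA, hB, ← sub_eq_zero]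
    constructor <;> intro h <;> linear_combination h
  rw [h0, hX, hX]
  constructor
  · intro h
    have h1 : A = 0 := congrFun h 0
    have h2 : B = 0 := congrFun h 1
    simp [h1, h2]
  · rintro ⟨h1, h2⟩
    have hA0 : A = 0 := by
      apply (mul_eq_zero.1 (_ : planeDet X Y * A = 0)).resolve_left h
      rw [planeDet]; linear_combination Y.2 * h1 - X.2 * h2
    have hB0 : B = 0 := by
      apply (mul_eq_zero.1 (_ : planeDet X Y * B = 0)).resolve_left h
      rw [planeDet]; linear_combination X.1 * h2 - Y.1 * h1
    ext i
    fin_cases i <;> simp [hA0, hB0]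

end Plane

/-! ### Fronts near a non-degenerate singular point: the adapted frame. -/

section

variable {D : Set Plane} {f ν : Plane → Space} {p : Plane}

namespace IsFront

theorem contDiffOn_fderiv (hD : IsOpen D) (hf : IsFront D f ν) :
    ContDiffOn ℝ ∞ (fderiv ℝ f) D :=
  hf.smooth.fderiv_of_isOpen hD (by simp)

theorem contDiffOn_fderiv_normal (hD : IsOpen D) (hf : IsFront D f ν) :
    ContDiffOn ℝ ∞ (fderiv ℝ ν) D :=
  hf.smooth_normal.fderiv_of_isOpen hD (by simp)

theorem contDiffOn_areaDensity (hD : IsOpen D) (hf : IsFront D f ν) :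
    ContDiffOn ℝ ∞ (areaDensity f ν) D := by
  have h := hf.contDiffOn_fderiv hD
  refine (ContDiffOn.inner ℝ (h.clm_apply contDiffOn_const)
    (hf.smooth_normal.frontCross (h.clm_apply contDiffOn_const))).congr
    fun q _ => areaDensity_eq f ν q

/-- Differentiating `⟨df X, ν⟩ = 0` along `Y` gives `-⟨d²f(Y, X), ν⟩`, and the second derivative is
symmetric. -/
theorem inner_fderiv_normal_comm (hD : IsOpen D) (hf : IsFront D f ν) {q : Plane} (hq : q ∈ D)
    (X Y : Plane) :
    inner ℝ (fderiv ℝ f q X) (fderiv ℝ ν q Y) = inner ℝ (fderiv ℝ f q Y) (fderiv ℝ ν q X) := by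
  have hDq := hD.mem_nhds hq
  have hf2 : DifferentiableAt ℝ (fderiv ℝ f) q :=
    ((hf.contDiffOn_fderiv hD).contDiffAt hDq).differentiableAt (by simp)
  have hν : DifferentiableAt ℝ ν q := (hf.smooth_normal.contDiffAt hDq).differentiableAt (by simp)
  have key : ∀ X Y : Plane, inner ℝ (fderiv ℝ f q X) (fderiv ℝ ν q Y) =
      -inner ℝ (fderiv ℝ (fderiv ℝ f) q Y X) (ν q) := by
    intro X Y
    have h0 : (fun x => inner ℝ (fderiv ℝ f x X) (ν x)) =ᶠ[𝓝 q] fun _ => (0 : ℝ) := by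
      filter_upwards [hDq] with x hx using hf.orthogonal x hx X
    have h1 := fderiv_inner_apply ℝ (hf2.clm_apply (differentiableAt_const X)) hν Y
    rw [h0.fderiv_eq, fderiv_clm_apply hf2 (differentiableAt_const X)] at h1
    simp at h1
    linarith
  have hs : IsSymmSndFDerivAt ℝ f q :=
    (hf.smooth.contDiffAt hDq).isSymmSndFDerivAt
      (by rw [minSmoothness_of_isRCLikeNormedField]; exact WithTop.coe_le_coe.2 le_top)
  rw [key, key, hs.eq]

theorem inner_normal_fderiv_normal (hD : IsOpen D) (hf : IsFront D f ν) {q : Plane} (hq : q ∈ D)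
    (X : Plane) : inner ℝ (fderiv ℝ ν q X) (ν q) = 0 := by
  have hDq := hD.mem_nhds hq
  have hν : DifferentiableAt ℝ ν q := (hf.smooth_normal.contDiffAt hDq).differentiableAt (by simp)
  have h0 : (fun x => inner ℝ (ν x) (ν x)) =ᶠ[𝓝 q] fun _ => (1 : ℝ) := by
    filter_upwards [hDq] with x hx
    rw [real_inner_self_eq_norm_sq, hf.norm_normal x hx, one_pow]
  have h1 := fderiv_inner_apply ℝ hν hν X
  rw [h0.fderiv_eq, real_inner_comm] at h1
  simp at h1
  linarith

/-- At a singular point where `dλ ≠ 0`, the differential of `f` does not vanish. -/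
theorem fderiv_ne_zero (hD : IsOpen D) (hf : IsFront D f ν)
    (hp : IsNondegenerateSingular D f ν p) : fderiv ℝ f p ≠ 0 := by
  intro h0
  apply hp.2
  have hDp := hD.mem_nhds hp.1.1
  have h := hf.contDiffOn_fderiv hD
  have hu : DifferentiableAt ℝ (fun q => cross (ν q) (partialU f q)) p :=
    ((hf.smooth_normal.frontCross (h.clm_apply contDiffOn_const)).contDiffAt
      hDp).differentiableAt (by simp)
  have hv : DifferentiableAt ℝ (partialV f) p :=
    ((h.clm_apply contDiffOn_const).contDiffAt hDp).differentiableAt (by simp)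
  have e : areaDensity f ν = fun q => inner ℝ (partialV f q) (cross (ν q) (partialU f q)) :=
    funext (areaDensity_eq f ν)
  have hv0 : partialV f p = 0 := by simp [partialV, h0]
  have hu0 : cross (ν p) (partialU f p) = 0 := by
    have : partialU f p = 0 := by simp [partialU, h0]
    rw [this]
    ext i
    fin_cases i <;> simp [cross]
  refine ContinuousLinearMap.ext fun X => ?_
  -- Both factors of the inner product vanish at `p`, so the product rule gives zero.
  rw [e, fderiv_inner_apply ℝ hv hu, hv0, hu0]
  simp

end IsFront

/-- A moving frame `a`, `η` near a non-degenerate singular point `p` of a front, where `a` is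
constant, `df(η) = λ h` is orthogonal to `df(a)`, and `h` never vanishes. -/
structure IsAdaptedFrame (D : Set Plane) (f ν : Plane → Space) (p : Plane) (W : Set Plane)
    (a : Plane) (η : Plane → Plane) (h : Plane → Space) : Prop where
  isOpen : IsOpen W
  mem : p ∈ W
  subset : W ⊆ D
  smooth_null : ContDiffOn ℝ ∞ η W
  smooth_vec : ContDiffOn ℝ ∞ h W
  fderiv_null : ∀ q ∈ W, fderiv ℝ f q (η q) = areaDensity f ν q • h q
  det_ne_zero : ∀ q ∈ W, planeDet a (η q) ≠ 0
  orthogonal : ∀ q ∈ W, inner ℝ (fderiv ℝ f q a) (h q) = 0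
  fderiv_ne_zero : ∀ q ∈ W, fderiv ℝ f q a ≠ 0
  vec_ne_zero : ∀ q ∈ W, h q ≠ 0
  fderiv_density_ne_zero : ∀ q ∈ W, fderiv ℝ (areaDensity f ν) q ≠ 0
  density_eq_zero : areaDensity f ν p = 0
  inner_ne_zero : ∀ q ∈ W, inner ℝ (h q) (fderiv ℝ ν q (η q)) ≠ 0

/-- Start from a kernel vector `b` at `p` and a complementary `a`, and apply Gram–Schmidt to `df(b)`
against `df(a)`. The resulting `df(η)` is orthogonal to `ν` and to `df(a)`, hence a multiple of `ν ×
df(a)`, and the factor is `λ` up to a nonvanishing function. -/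
theorem exists_isAdaptedFrame (hD : IsOpen D) (hf : IsFront D f ν)
    (hp : IsNondegenerateSingular D f ν p) :
    ∃ W a η h, IsAdaptedFrame D f ν p W a η h := by
  have hpD := hp.1.1
  have hDp := hD.mem_nhds hpD
  obtain ⟨b, hb0, hb⟩ : ∃ b : Plane, fderiv ℝ f p b = 0 ∧ b ≠ 0 := by
    have := hp.1.2
    rw [injective_iff_map_eq_zero] at this
    push Not at this
    exact this
  set a : Plane := (-b.2, b.1) with ha
  have hδ : planeDet a b ≠ 0 := by
    intro h
    apply hb
    have h' : b.1 ^ 2 + b.2 ^ 2 = 0 := by simp only [planeDet, ha] at h; linarith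
    ext
    · exact pow_eq_zero_iff two_ne_zero |>.1 (by nlinarith [sq_nonneg b.1, sq_nonneg b.2])
    · exact pow_eq_zero_iff two_ne_zero |>.1 (by nlinarith [sq_nonneg b.1, sq_nonneg b.2])
  have hap : fderiv ℝ f p a ≠ 0 := by
    intro h
    apply hf.fderiv_ne_zero hD hp
    refine ContinuousLinearMap.ext fun X => ?_
    have := congrArg (fderiv ℝ f p) (planeDet_smul_eq a b X)
    simp only [map_smul, map_add, h, hb0, smul_zero, add_zero] at this
    simpa using (smul_eq_zero.1 this).resolve_left hδ
  set fa : Plane → Space := fun q => fderiv ℝ f q a with hfa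
  set fb : Plane → Space := fun q => fderiv ℝ f q b with hfb
  have hdf := hf.contDiffOn_fderiv hD
  have sfa : ContDiffOn ℝ ∞ fa D := hdf.clm_apply contDiffOn_const
  have sfb : ContDiffOn ℝ ∞ fb D := hdf.clm_apply contDiffOn_const
  have hlam := hf.contDiffOn_areaDensity hD
  set η : Plane → Plane := fun q => b - (inner ℝ (fb q) (fa q) / inner ℝ (fa q) (fa q)) • a with hη
  set h : Plane → Space :=
    fun q => (planeDet a b / inner ℝ (fa q) (fa q)) • cross (ν q) (fa q) with hh
  have hEne : ∀ q, fa q ≠ 0 → inner ℝ (fa q) (fa q) ≠ 0 := fun q hq => inner_self_ne_zero.2 hq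
  set D' : Set Plane := D ∩ fa ⁻¹' {0}ᶜ with hD'
  have hD'o : IsOpen D' := sfa.continuousOn.isOpen_inter_preimage hD isOpen_compl_singleton
  have hD'D : D' ⊆ D := inter_subset_left
  have hpD' : p ∈ D' := ⟨hpD, hap⟩
  have sE : ContDiffOn ℝ ∞ (fun q => inner ℝ (fa q) (fa q)) D' :=
    (ContDiffOn.inner ℝ sfa sfa).mono hD'D
  have hE : ∀ q ∈ D', inner ℝ (fa q) (fa q) ≠ 0 := fun q hq => hEne q hq.2
  have sη : ContDiffOn ℝ ∞ η D' :=
    contDiffOn_const.sub ((((ContDiffOn.inner ℝ sfb sfa).mono hD'D).div sE hE).smul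
      contDiffOn_const)
  have sh : ContDiffOn ℝ ∞ h D' :=
    (contDiffOn_const.div sE hE).smul ((hf.smooth_normal.frontCross sfa).mono hD'D)
  have det : ∀ q, planeDet a (η q) = planeDet a b := by
    intro q; simp [planeDet, hη]; ring
  have hcc : ∀ q ∈ D, inner ℝ (cross (ν q) (fa q)) (cross (ν q) (fa q)) =
      inner ℝ (fa q) (fa q) := by
    intro q hq
    rw [inner_cross_cross, real_inner_comm (fa q) (ν q), hf.orthogonal q hq a,
      real_inner_self_eq_norm_sq (ν q), hf.norm_normal q hq]
    ring
  have hnull : ∀ q ∈ D', fderiv ℝ f q (η q) = areaDensity f ν q • h q := by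
    intro q hq
    have hw1 := hf.orthogonal q hq.1 (η q)
    have hw2 : inner ℝ (fderiv ℝ f q (η q)) (fa q) = 0 := by
      simp only [hη, map_sub, map_smul, inner_sub_left, inner_smul_left, conj_trivial]
      have := hE q hq
      change inner ℝ (fb q) (fa q) - _ / _ * inner ℝ (fa q) (fa q) = 0
      field_simp
      ring
    have := smul_eq_inner_smul_cross hw1 hw2
    rw [hcc q hq.1, inner_fderiv_cross, det] at this
    rw [hh]
    simp only [smul_smul]
    rw [← inv_smul_smul₀ (hE q hq) (fderiv ℝ f q (η q)), this, smul_smul]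
    congr 1
    field_simp
  have hdens : areaDensity f ν p = 0 := by
    have h1 := inner_fderiv_cross f ν p a b
    rw [hb0, inner_zero_left] at h1
    exact (mul_eq_zero.1 h1.symm).resolve_left hδ
  have hηp : η p = b := by simp [hη, hfb, hb0]
  have hcross : ∀ q ∈ D', cross (ν q) (fa q) ≠ 0 := by
    intro q hq h0
    have := hcc q hq.1
    rw [h0, inner_zero_left] at this
    exact hE q hq this.symm
  -- The front condition gives `dν(b) ≠ 0` at `p`. This vector is orthogonal to `ν`, and to `df(a)`
  -- by symmetry of the second form, so it is a nonzero multiple of `ν × df(a)`.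
  have hNp : inner ℝ (h p) (fderiv ℝ ν p (η p)) ≠ 0 := by
    rw [hηp]
    intro h0
    have h1 : fderiv ℝ ν p b ≠ 0 := by
      intro h1
      apply hb
      apply hf.immersion p hpD
      have d1 : DifferentiableAt ℝ f p := (hf.smooth.contDiffAt hDp).differentiableAt (by simp)
      have d2 : DifferentiableAt ℝ ν p :=
        (hf.smooth_normal.contDiffAt hDp).differentiableAt (by simp)
      rw [d1.fderiv_prodMk d2]
      simp [hb0, h1]
    apply h1
    have hw2 : inner ℝ (fderiv ℝ ν p b) (fa p) = 0 := by
      rw [real_inner_comm, hfa, hf.inner_fderiv_normal_comm hD hpD, hb0, inner_zero_left]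
    have h2 := smul_eq_inner_smul_cross (hf.inner_normal_fderiv_normal hD hpD b) hw2
    have h3 : inner ℝ (fderiv ℝ ν p b) (cross (ν p) (fa p)) = 0 := by
      rw [hh] at h0
      simp only [inner_smul_left, conj_trivial, mul_eq_zero] at h0
      rw [real_inner_comm]
      exact h0.resolve_left (div_ne_zero hδ (hE p hpD'))
    rw [h3, zero_smul, hcc p hpD] at h2
    exact (smul_eq_zero.1 h2).resolve_left (hE p hpD')
  have sN : ContDiffOn ℝ ∞ (fun q => inner ℝ (h q) (fderiv ℝ ν q (η q))) D' :=
    ContDiffOn.inner ℝ sh (((hf.contDiffOn_fderiv_normal hD).mono hD'D).clm_apply sη)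
  have sdl : ContDiffOn ℝ ∞ (fderiv ℝ (areaDensity f ν)) D := hlam.fderiv_of_isOpen hD (by simp)
  have hD'p := hD'o.mem_nhds hpD'
  have ev1 := ((sN.contDiffAt hD'p).continuousAt).eventually_ne hNp
  have ev2 := ((sdl.contDiffAt hDp).continuousAt).eventually_ne hp.2
  obtain ⟨W, hW, hWo, hpW⟩ := eventually_nhds_iff.1 (ev1.and (ev2.and hD'p))
  have hWD' : W ⊆ D' := fun q hq => (hW q hq).2.2
  exact ⟨W, a, η, h, hWo, hpW, hWD'.trans hD'D, sη.mono hWD', sh.mono hWD',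
    fun q hq => hnull q (hWD' hq), fun q _ => by rw [det]; exact hδ,
    fun q hq => by
      change inner ℝ (fa q) (h q) = 0
      rw [hh, inner_smul_right, inner_cross_self_right, mul_zero],
    fun q hq => (hWD' hq).2,
    fun q hq => smul_ne_zero (div_ne_zero hδ (hE q (hWD' hq))) (hcross q (hWD' hq)),
    fun q hq => (hW q hq).2.1, hdens, fun q hq => (hW q hq).1⟩

/-- The principal curvatures near a non-degenerate singular point of a front: the bounded one is
the smooth function `κ`, the other one is `ρ / λ` with `ρ` smooth and non-vanishing, and
`x a + y η` is a principal vector of the latter exactly when `x S + y T = 0`. -/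
structure IsCurvatureData (D : Set Plane) (f ν : Plane → Space) (p : Plane) (W : Set Plane)
    (a : Plane) (η : Plane → Plane) (κ ρ S T : Plane → ℝ) : Prop where
  isOpen : IsOpen W
  mem : p ∈ W
  subset : W ⊆ D
  smooth_null : ContDiffOn ℝ ∞ η W
  smooth_curvature : ContDiffOn ℝ ∞ κ W
  smooth_factor : ContDiffOn ℝ ∞ ρ W
  smooth_coeff : ContDiffOn ℝ ∞ S W
  smooth_coeff' : ContDiffOn ℝ ∞ T W
  factor_ne_zero : ∀ q ∈ W, ρ q ≠ 0
  coeff_ne_zero : ∀ q ∈ W, S q ≠ 0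
  coeff'_eq_zero : T p = 0
  density_eq_zero : areaDensity f ν p = 0
  fderiv_density_ne_zero : ∀ q ∈ W, fderiv ℝ (areaDensity f ν) q ≠ 0
  det_ne_zero : ∀ q ∈ W, planeDet a (η q) ≠ 0
  null : fderiv ℝ f p (η p) = 0
  injective_iff : ∀ q ∈ W, Function.Injective (fderiv ℝ f q) ↔ areaDensity f ν q ≠ 0
  mul_eq : ∀ q ∈ W, areaDensity f ν q ≠ 0 →
    κ q * (ρ q / areaDensity f ν q) = gaussCurvature f ν q
  add_eq : ∀ q ∈ W, areaDensity f ν q ≠ 0 →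
    κ q + ρ q / areaDensity f ν q = 2 * meanCurvature f ν q
  principal_iff : ∀ q ∈ W, areaDensity f ν q ≠ 0 → ∀ (x y : ℝ) (V : Plane),
    V = x • a + y • η q →
      (Matrix.mulVec (secondForm f ν q - (ρ q / areaDensity f ν q) • firstForm f q)
        ![V.1, V.2] = 0 ↔ x * S q + y * T q = 0)

/-! ### Principal curvatures in an adapted frame. -/

namespace IsAdaptedFrame

variable {W : Set Plane} {a : Plane} {η : Plane → Plane} {h : Plane → Space}

theorem injective_iff (hF : IsAdaptedFrame D f ν p W a η h) {q : Plane} (hq : q ∈ W) :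
    Function.Injective (fderiv ℝ f q) ↔ areaDensity f ν q ≠ 0 := by
  constructor
  · intro hi h0
    have h1 : fderiv ℝ f q (η q) = 0 := by rw [hF.fderiv_null q hq, h0, zero_smul]
    have h2 : η q = 0 := hi (by rw [h1, map_zero])
    exact hF.det_ne_zero q hq (by simp [h2, planeDet])
  · intro h0
    rw [injective_iff_map_eq_zero]
    intro X hX
    set δ := planeDet a (η q)
    have h1 := congrArg (fderiv ℝ f q) (planeDet_smul_eq a (η q) X)
    simp only [map_smul, map_add, hX, smul_zero, hF.fderiv_null q hq] at h1
    have h2 := congrArg (fun Z => inner ℝ (fderiv ℝ f q a) Z) h1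
    have h3 := congrArg (fun Z => inner ℝ Z (h q)) h1
    simp only [inner_zero_right, inner_zero_left, inner_add_left, inner_add_right,
      inner_smul_left, inner_smul_right, hF.orthogonal q hq, mul_zero, add_zero, zero_add,
      conj_trivial] at h2 h3
    have h4 : planeDet X (η q) = 0 :=
      (mul_eq_zero.1 h2.symm).resolve_right (inner_self_ne_zero.2 (hF.fderiv_ne_zero q hq))
    have h5 : planeDet a X = 0 :=
      (mul_eq_zero.1 h3.symm).resolve_right
        (mul_ne_zero h0 (inner_self_ne_zero.2 (hF.vec_ne_zero q hq)))
    have h6 := planeDet_smul_eq a (η q) X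
    rw [h4, h5, zero_smul, zero_smul, add_zero] at h6
    exact (smul_eq_zero.1 h6).resolve_left (hF.det_ne_zero q hq)

end IsAdaptedFrame

/-- In the adapted frame `2H = B / (λ E G)` and `K = C / (λ E G)`. A principal curvature written as
`R / (λ E G)` thus satisfies `R² - B R + λ E G C = 0`, whose roots at `λ = 0` are `B ≠ 0` and `0`.
The nonzero root gives `ρ / λ`; by the product of the curvatures the other one is `C / R`, which is
smooth. -/
theorem exists_isCurvatureData (hD : IsOpen D) (hf : IsFront D f ν)
    (hp : IsNondegenerateSingular D f ν p) :
    ∃ W a η κ ρ S T, IsCurvatureData D f ν p W a η κ ρ S T := by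
  obtain ⟨W, a, η, h, hF⟩ := exists_isAdaptedFrame hD hf hp
  set lam := areaDensity f ν with hlam
  have slam : ContDiffOn ℝ ∞ lam W := (hf.contDiffOn_areaDensity hD).mono hF.subset
  have sf := (hf.contDiffOn_fderiv hD).mono hF.subset
  have sν := (hf.contDiffOn_fderiv_normal hD).mono hF.subset
  set E : Plane → ℝ := fun q => inner ℝ (fderiv ℝ f q a) (fderiv ℝ f q a) with hE
  set G : Plane → ℝ := fun q => inner ℝ (h q) (h q) with hG
  set L : Plane → ℝ := fun q => -inner ℝ (fderiv ℝ f q a) (fderiv ℝ ν q a) with hL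
  set M : Plane → ℝ := fun q => -inner ℝ (h q) (fderiv ℝ ν q a) with hM
  set N : Plane → ℝ := fun q => -inner ℝ (h q) (fderiv ℝ ν q (η q)) with hN
  have sfa : ContDiffOn ℝ ∞ (fun q => fderiv ℝ f q a) W := sf.clm_apply contDiffOn_const
  have sνa : ContDiffOn ℝ ∞ (fun q => fderiv ℝ ν q a) W := sν.clm_apply contDiffOn_const
  have sE : ContDiffOn ℝ ∞ E W := ContDiffOn.inner ℝ sfa sfa
  have sG : ContDiffOn ℝ ∞ G W := ContDiffOn.inner ℝ hF.smooth_vec hF.smooth_vec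
  have sL : ContDiffOn ℝ ∞ L W := (ContDiffOn.inner ℝ sfa sνa).neg
  have sM : ContDiffOn ℝ ∞ M W := (ContDiffOn.inner ℝ hF.smooth_vec sνa).neg
  have sN : ContDiffOn ℝ ∞ N W :=
    (ContDiffOn.inner ℝ hF.smooth_vec (sν.clm_apply hF.smooth_null)).neg
  have hEpos : ∀ q ∈ W, 0 < E q := fun q hq => real_inner_self_pos.2 (hF.fderiv_ne_zero q hq)
  have hGpos : ∀ q ∈ W, 0 < G q := fun q hq => real_inner_self_pos.2 (hF.vec_ne_zero q hq)
  have hNne : ∀ q ∈ W, N q ≠ 0 := fun q hq => neg_ne_zero.2 (hF.inner_ne_zero q hq)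
  -- `σ` is the sign of `N p`, hence of `B p`; it selects the root `R` that stays away from zero,
  -- with no cancellation.
  obtain ⟨σ, hσ, hσN⟩ : ∃ σ : ℝ, σ ^ 2 = 1 ∧ 0 < σ * N p := by
    rcases lt_or_gt_of_ne (hNne p hF.mem) with hn | hn
    · exact ⟨-1, by norm_num, by linarith⟩
    · exact ⟨1, by norm_num, by linarith⟩
  set B : Plane → ℝ := fun q => E q * N q + lam q * G q * L q with hB
  set C : Plane → ℝ := fun q => L q * N q - lam q * M q ^ 2 with hC
  set Δ : Plane → ℝ := fun q => B q ^ 2 - 4 * lam q * E q * G q * C q with hΔ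
  set R : Plane → ℝ := fun q => (B q + σ * √(Δ q)) / 2 with hR
  set ρ : Plane → ℝ := fun q => R q / (E q * G q) with hρ
  -- Coefficient of `x` in the `a`-component of the principal vector equation multiplied by `λ`;
  -- that of `y` is `T = λ² M`.
  set S : Plane → ℝ := fun q => lam q * L q - ρ q * E q with hS
  have sB : ContDiffOn ℝ ∞ B W := (sE.mul sN).add ((slam.mul sG).mul sL)
  have sC : ContDiffOn ℝ ∞ C W := (sL.mul sN).sub (slam.mul (sM.pow 2))
  have sΔ : ContDiffOn ℝ ∞ Δ W :=
    (sB.pow 2).sub ((((contDiffOn_const.mul slam).mul sE).mul sG).mul sC)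
  have hlp : lam p = 0 := hF.density_eq_zero
  have hW := hF.isOpen.mem_nhds hF.mem
  have hBp : 0 < σ * B p := by
    have := hEpos p hF.mem
    simp only [hB, hlp]
    nlinarith [mul_pos this hσN]
  have hΔp : 0 < Δ p := by
    have : B p ≠ 0 := by rintro h0; rw [h0] at hBp; simp at hBp
    simp only [hΔ, hlp]
    have := pow_pos (abs_pos.2 this) 2
    rw [sq_abs] at this
    linarith
  have evB : ∀ᶠ q in 𝓝 p, 0 < σ * B q :=
    (continuousAt_const.mul (sB.contDiffAt hW).continuousAt).eventually_const_lt hBp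
  have evΔ : ∀ᶠ q in 𝓝 p, 0 < Δ q := (sΔ.contDiffAt hW).continuousAt.eventually_const_lt hΔp
  obtain ⟨W₁, hW₁, hW₁o, hpW₁⟩ := eventually_nhds_iff.1 (evB.and (evΔ.and hW))
  have hW₁W : W₁ ⊆ W := fun q hq => (hW₁ q hq).2.2
  have sR : ContDiffOn ℝ ∞ R W₁ :=
    ((sB.mono hW₁W).add (contDiffOn_const.mul ((sΔ.mono hW₁W).sqrt
      fun q hq => (hW₁ q hq).2.1.ne'))).div_const 2
  have hRpos : ∀ q ∈ W₁, 0 < σ * R q := by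
    intro q hq
    have h1 := (hW₁ q hq).1
    have h2 := Real.sqrt_nonneg (Δ q)
    have : σ * R q = (σ * B q + σ ^ 2 * √(Δ q)) / 2 := by simp only [hR]; ring
    rw [this, hσ]
    linarith
  have hRne : ∀ q ∈ W₁, R q ≠ 0 := fun q hq h0 => by
    have := hRpos q hq; rw [h0] at this; simp at this
  have hRquad : ∀ q ∈ W₁, R q ^ 2 - B q * R q + lam q * E q * G q * C q = 0 := by
    intro q hq
    have h1 := Real.sq_sqrt (hW₁ q hq).2.1.le
    have h2 : Δ q = B q ^ 2 - 4 * lam q * E q * G q * C q := rfl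
    have h3 : R q = (B q + σ * √(Δ q)) / 2 := rfl
    have h4 : (2 * R q - B q) ^ 2 = Δ q := by rw [h3]; linear_combination σ ^ 2 * h1 + Δ q * hσ
    linear_combination h4 / 4 + h2 / 4
  have hEG : ∀ q ∈ W₁, E q * G q ≠ 0 := fun q hq =>
    mul_ne_zero (hEpos q (hW₁W hq)).ne' (hGpos q (hW₁W hq)).ne'
  have sρ : ContDiffOn ℝ ∞ ρ W₁ := sR.div ((sE.mul sG).mono hW₁W) hEG
  have hρne : ∀ q ∈ W₁, ρ q ≠ 0 := fun q hq => div_ne_zero (hRne q hq) (hEG q hq)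
  have sS : ContDiffOn ℝ ∞ S W₁ := ((slam.mul sL).mono hW₁W).sub (sρ.mul (sE.mono hW₁W))
  have hSp : S p ≠ 0 := by
    simp only [hS, hlp, zero_mul, zero_sub]
    exact neg_ne_zero.2 (mul_ne_zero (hρne p hpW₁) (hEpos p hF.mem).ne')
  have evS := ((sS.contDiffAt (hW₁o.mem_nhds hpW₁)).continuousAt).eventually_ne hSp
  obtain ⟨W₂, hW₂, hW₂o, hpW₂⟩ := eventually_nhds_iff.1 (evS.and (hW₁o.mem_nhds hpW₁))
  have hW₂₁ : W₂ ⊆ W₁ := fun q hq => (hW₂ q hq).2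
  have hW₂W : W₂ ⊆ W := hW₂₁.trans hW₁W
  have ηη : ∀ q ∈ W, second f ν q (η q) (η q) = lam q * N q := by
    intro q hq
    rw [second, hF.fderiv_null q hq, inner_smul_left]; simp [hN, hlam]
  have ηa : ∀ q ∈ W, second f ν q (η q) a = lam q * M q := by
    intro q hq
    rw [second, hF.fderiv_null q hq, inner_smul_left]; simp [hM, hlam]
  have aη : ∀ q ∈ W, second f ν q a (η q) = lam q * M q := by
    intro q hq
    rw [← ηa q hq, second, second, hf.inner_fderiv_normal_comm hD (hF.subset hq)]
  have Iηη : ∀ q ∈ W, first f q (η q) (η q) = lam q ^ 2 * G q := by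
    intro q hq
    rw [first, hF.fderiv_null q hq, inner_smul_left, inner_smul_right]; simp [hG, hlam]; ring
  have Iaη : ∀ q ∈ W, first f q a (η q) = 0 := by
    intro q hq
    rw [first, hF.fderiv_null q hq, inner_smul_right, hF.orthogonal q hq, mul_zero]
  have Iηa : ∀ q ∈ W, first f q (η q) a = 0 := by
    intro q hq
    rw [first, real_inner_comm]; exact Iaη q hq
  have aa : ∀ q, second f ν q a a = L q := fun q => rfl
  have Iaa : ∀ q, first f q a a = E q := fun q => rfl
  refine ⟨W₂, a, η, fun q => C q / R q, ρ, S, fun q => lam q ^ 2 * M q, hW₂o, hpW₂,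
    hW₂W.trans hF.subset, hF.smooth_null.mono hW₂W, (sC.mono hW₂W).div (sR.mono hW₂₁)
      fun q hq => hRne q (hW₂₁ hq), sρ.mono hW₂₁, sS.mono hW₂₁,
    ((slam.pow 2).mul sM).mono hW₂W, fun q hq => hρne q (hW₂₁ hq), fun q hq => (hW₂ q hq).1,
    by simp [hlp], hlp, fun q hq => hF.fderiv_density_ne_zero q (hW₂W hq),
    fun q hq => hF.det_ne_zero q (hW₂W hq), ?_, fun q hq => hF.injective_iff (hW₂W hq),
    ?_, ?_, ?_⟩
  · rw [hF.fderiv_null p hF.mem, hF.density_eq_zero, zero_smul]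
  · intro q hq hl
    have hqW := hW₂W hq
    have h1 := hRne q (hW₂₁ hq)
    have h2 := (hEpos q hqW).ne'
    have h3 := (hGpos q hqW).ne'
    rw [gaussCurvature_eq f ν q (hF.det_ne_zero q hqW), ηη q hqW, ηa q hqW, aη q hqW, aa, Iaa,
      Iηη q hqW, Iaη q hqW]
    have h4 : ρ q = R q / (E q * G q) := rfl
    have h5 : C q = L q * N q - lam q * M q ^ 2 := rfl
    change lam q ≠ 0 at hl
    change C q / R q * (ρ q / lam q) = _
    rw [h4]
    field_simp
    rw [h5]
    ring
  · intro q hq hl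
    have hqW := hW₂W hq
    have h1 := hRne q (hW₂₁ hq)
    have h2 := (hEpos q hqW).ne'
    have h3 := (hGpos q hqW).ne'
    rw [two_mul_meanCurvature_eq f ν q (hF.det_ne_zero q hqW), ηη q hqW, ηa q hqW, aη q hqW, aa,
      Iaa, Iηη q hqW, Iaη q hqW]
    have h4 : ρ q = R q / (E q * G q) := rfl
    have h5 : B q = E q * N q + lam q * G q * L q := rfl
    have h6 := hRquad q (hW₂₁ hq)
    change lam q ≠ 0 at hl
    change C q / R q + ρ q / lam q = _
    have h7 : (E q * (lam q * N q) - 0 * (lam q * M q + lam q * M q) + lam q ^ 2 * G q * L q) /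
        (E q * (lam q ^ 2 * G q) - 0 ^ 2) = B q / (lam q * E q * G q) := by
      rw [h5]; field_simp; ring
    rw [h7, h4]
    field_simp
    linear_combination h6
  · rintro q hq hl x y V rfl
    have hqW := hW₂W hq
    have h2 := (hEpos q hqW).ne'
    have h3 := (hGpos q hqW).ne'
    change lam q ≠ 0 at hl
    have hS0 : S q ≠ 0 := (hW₂ q hq).1
    have h4 : R q = ρ q * (E q * G q) := by
      simp only [hρ]; field_simp
    have h5 : B q = E q * N q + lam q * G q * L q := rfl
    have h6 := hRquad q (hW₂₁ hq)
    have h7 : S q = lam q * L q - ρ q * E q := rfl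
    have h8 : C q = L q * N q - lam q * M q ^ 2 := rfl
    rw [principal_iff f ν q _ _ (hF.det_ne_zero q hqW)]
    have b1 : ∀ X, second f ν q X (x • a + y • η q) =
        x * second f ν q X a + y * second f ν q X (η q) := by
      intro X
      simp only [second, map_add, map_smul, inner_add_right, inner_smul_right]; ring
    have b2 : ∀ X, first f q X (x • a + y • η q) =
        x * first f q X a + y * first f q X (η q) := by
      intro X
      simp only [first, map_add, map_smul, inner_add_right, inner_smul_right]
    rw [b1, b1, b2, b2, ηη q hqW, ηa q hqW, aη q hqW, aa, Iaa, Iηη q hqW, Iaη q hqW, Iηa q hqW]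
    change (_ = ρ q / lam q * _ ∧ _ = ρ q / lam q * _) ↔ x * S q + y * (lam q ^ 2 * M q) = 0
    have e1 : (x * L q + y * (lam q * M q) = ρ q / lam q * (x * E q + y * 0)) ↔
        x * S q + y * (lam q ^ 2 * M q) = 0 := by
      rw [h7]
      field_simp
      constructor <;> intro h <;> linear_combination h
    rw [e1, and_iff_left_iff_imp]
    intro hx
    -- The `η`-component, divided by `λ`, follows from the `a`-component and the characteristic
    -- equation `h6`, since the form is degenerate for an eigenvalue.
    have e2 : x * M q + y * (N q - ρ q * G q) = 0 := by
      apply (mul_eq_zero.1 (_ : (S q * (E q * G q)) * _ = 0)).resolve_left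
        (mul_ne_zero hS0 (mul_ne_zero h2 h3))
      rw [h4, h5, h8] at h6
      rw [h7] at hx ⊢
      linear_combination E q * G q * M q * hx + y * h6
    have e3 : ρ q / lam q * (x * 0 + y * (lam q ^ 2 * G q)) = ρ q * y * lam q * G q := by
      field_simp
      ring
    rw [e3]
    linear_combination lam q * e2

theorem eq_zero_of_frequently {X : Type*} [TopologicalSpace X] {F : X → ℝ} {q : X}
    (hF : ContinuousAt F q) (h : ∃ᶠ x in 𝓝 q, F x = 0) : F q = 0 := by
  by_contra h0
  exact h (hF.eventually_ne h0)

theorem map_eq_zero_of_planeDet {ℓ : Plane →L[ℝ] ℝ} {X Y : Plane} (hX : X ≠ 0) (hℓ : ℓ X = 0)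
    (h : planeDet X Y = 0) : ℓ Y = 0 := by
  have h1 : planeDet X (-X.2, X.1) ≠ 0 := by
    intro h1
    apply hX
    simp only [planeDet] at h1
    ext
    · exact pow_eq_zero_iff two_ne_zero |>.1 (by nlinarith [sq_nonneg X.1, sq_nonneg X.2])
    · exact pow_eq_zero_iff two_ne_zero |>.1 (by nlinarith [sq_nonneg X.1, sq_nonneg X.2])
  have h2 := congrArg ℓ (planeDet_smul_eq X (-X.2, X.1) Y)
  rw [h, map_smul, map_add, map_smul, map_smul, hℓ] at h2
  simp only [smul_eq_mul, mul_zero, zero_mul, add_zero] at h2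
  exact (mul_eq_zero.1 h2).resolve_left h1

theorem IsFront.planeDet_eq_zero (hD : IsOpen D) (hf : IsFront D f ν)
    (hp : IsNondegenerateSingular D f ν p) {X Y : Plane} (hX : fderiv ℝ f p X = 0)
    (hY : fderiv ℝ f p Y = 0) : planeDet X Y = 0 := by
  by_contra h
  apply hf.fderiv_ne_zero hD hp
  refine ContinuousLinearMap.ext fun Z => ?_
  have := congrArg (fderiv ℝ f p) (planeDet_smul_eq X Y Z)
  simp only [map_smul, map_add, hX, hY, smul_zero, add_zero] at this
  simpa using (smul_eq_zero.1 this).resolve_left h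

/-! ### Bounded Gaussian curvature and sub-parabolic points. -/

namespace IsCurvatureData

variable {W : Set Plane} {a : Plane} {η : Plane → Plane} {κ ρ S T : Plane → ℝ}

theorem mem_regularSet_iff (hC : IsCurvatureData D f ν p W a η κ ρ S T) {q : Plane} (hq : q ∈ W) :
    q ∈ regularSet D f ↔ areaDensity f ν q ≠ 0 := by
  rw [← hC.injective_iff q hq]
  exact ⟨fun h => h.2, fun h => ⟨hC.subset hq, h⟩⟩

theorem contDiffAt_density (hD : IsOpen D) (hf : IsFront D f ν)
    (hC : IsCurvatureData D f ν p W a η κ ρ S T) {q : Plane} (hq : q ∈ W) :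
    ContDiffAt ℝ ∞ (areaDensity f ν) q :=
  (hf.contDiffOn_areaDensity hD).contDiffAt (hD.mem_nhds (hC.subset hq))

theorem frequently_density_ne_zero (hC : IsCurvatureData D f ν p W a η κ ρ S T) {q : Plane}
    (hq : q ∈ W) : ∃ᶠ x in 𝓝 q, areaDensity f ν x ≠ 0 :=
  frequently_ne_zero_of_fderiv_ne_zero (hC.fderiv_density_ne_zero q hq)

/-- At regular points this says `|g / λ| > c`: a nonvanishing numerator over `λ` blows up at the
singular set. -/
theorem eventually_mul_lt (hD : IsOpen D) (hf : IsFront D f ν)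
    (hC : IsCurvatureData D f ν p W a η κ ρ S T) {g : Plane → ℝ} {q : Plane} (hq : q ∈ W)
    (h0 : areaDensity f ν q = 0) (hg : ContinuousAt g q) (hgq : g q ≠ 0) (c : ℝ) :
    ∀ᶠ x in 𝓝 q, c * |areaDensity f ν x| < |g x| := by
  have h1 : ContinuousAt (fun x => |g x| - c * |areaDensity f ν x|) q :=
    hg.abs.sub (continuousAt_const.mul (hC.contDiffAt_density hD hf hq).continuousAt.abs)
  have h2 : 0 < |g q| - c * |areaDensity f ν q| := by simpa [h0] using hgq
  filter_upwards [h1.eventually_const_lt h2] with x hx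
  linarith

/-- Otherwise `K = κ ρ / λ` would blow up at that singular point, which is a limit of regular
points. -/
theorem curvature_eq_zero (hD : IsOpen D) (hf : IsFront D f ν)
    (hC : IsCurvatureData D f ν p W a η κ ρ S T)
    (hK : IsBoundedNear D f p (gaussCurvature f ν)) :
    ∀ᶠ q in 𝓝 p, areaDensity f ν q = 0 → κ q = 0 := by
  obtain ⟨U, hUo, hpU, c, hc⟩ := hK
  filter_upwards [hUo.mem_nhds hpU, hC.isOpen.mem_nhds hC.mem] with q hqU hqW hq0
  by_contra hκ
  have hWq := hC.isOpen.mem_nhds hqW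
  have hcont : ContinuousAt (fun x => κ x * ρ x) q :=
    (hC.smooth_curvature.contDiffAt hWq).continuousAt.mul
      (hC.smooth_factor.contDiffAt hWq).continuousAt
  have h1 := hC.eventually_mul_lt hD hf hqW hq0 hcont
    (mul_ne_zero hκ (hC.factor_ne_zero q hqW)) c
  obtain ⟨x, hx0, hx1, hxU, hxW⟩ := ((hC.frequently_density_ne_zero hqW).and_eventually
    (h1.and ((hUo.eventually_mem hqU).and hWq))).exists
  have h2 := hc x ⟨(hC.mem_regularSet_iff hxW).2 hx0, hxU⟩
  rw [← hC.mul_eq x hxW hx0, ← mul_div_assoc, abs_div, div_le_iff₀ (abs_pos.2 hx0)] at h2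
  linarith

/-- The bounded principal curvature is `c λ + o(λ)`, and the Gaussian curvature tends to
`c ρ(p)`. -/
theorem exists_tendsto_gaussCurvature (hD : IsOpen D) (hf : IsFront D f ν)
    (hC : IsCurvatureData D f ν p W a η κ ρ S T)
    (hK : IsBoundedNear D f p (gaussCurvature f ν)) :
    ∃ c : ℝ, fderiv ℝ κ p = c • fderiv ℝ (areaDensity f ν) p ∧
      Tendsto (gaussCurvature f ν) (𝓝[regularSet D f] p) (𝓝 (c * ρ p)) := by
  have hW := hC.isOpen.mem_nhds hC.mem
  have hc1 : ∀ᶠ q in 𝓝 p, ContinuousAt (areaDensity f ν) q := by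
    filter_upwards [hW] with q hq using (hC.contDiffAt_density hD hf hq).continuousAt
  obtain ⟨c, h1, h2⟩ := exists_isLittleO_of_vanishing
    ((hC.contDiffAt_density hD hf hC.mem).hasStrictFDerivAt (by simp)) hc1 hC.density_eq_zero
    (hC.fderiv_density_ne_zero p hC.mem)
    ((hC.smooth_curvature.contDiffAt hW).hasStrictFDerivAt (by simp))
    (hC.curvature_eq_zero hD hf hK)
  refine ⟨c, h1, ?_⟩
  have h3 : Tendsto (fun q => (c + (κ q - c * areaDensity f ν q) / areaDensity f ν q) * ρ q)
      (𝓝[regularSet D f] p) (𝓝 (c * ρ p)) := by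
    have h4 := (tendsto_const_nhds (x := c)).add (h2.tendsto_div_nhds_zero)
    rw [add_zero] at h4
    exact (h4.mul (hC.smooth_factor.contDiffAt hW).continuousAt.tendsto).mono_left
      nhdsWithin_le_nhds
  refine h3.congr' ?_
  filter_upwards [self_mem_nhdsWithin, mem_nhdsWithin_of_mem_nhds hW] with q hq hqW
  have h0 := (hC.mem_regularSet_iff hqW).1 hq
  rw [← hC.mul_eq q hqW h0]
  field_simp
  ring

theorem not_isBoundedNear (hD : IsOpen D) (hf : IsFront D f ν)
    (hC : IsCurvatureData D f ν p W a η κ ρ S T) :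
    ¬ IsBoundedNear D f p (fun q => ρ q / areaDensity f ν q) := by
  rintro ⟨U, hUo, hpU, c, hc⟩
  have hW := hC.isOpen.mem_nhds hC.mem
  have h1 := hC.eventually_mul_lt hD hf hC.mem hC.density_eq_zero
    (hC.smooth_factor.contDiffAt hW).continuousAt (hC.factor_ne_zero p hC.mem) c
  obtain ⟨x, hx0, hx1, hxU, hxW⟩ := ((hC.frequently_density_ne_zero hC.mem).and_eventually
    (h1.and ((hUo.eventually_mem hpU).and hW))).exists
  have h2 := hc x ⟨(hC.mem_regularSet_iff hxW).2 hx0, hxU⟩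
  rw [abs_div, div_le_iff₀ (abs_pos.2 hx0)] at h2
  linarith

/-- The principal field solves `x S + y T = 0` with `y = 1`; it equals `η` at `p` because `T p = 0`.
-/
theorem isSubparabolic (hD : IsOpen D) (hf : IsFront D f ν)
    (hC : IsCurvatureData D f ν p W a η κ ρ S T) (h : fderiv ℝ κ p (η p) = 0) :
    IsSubparabolic D f ν p := by
  refine ⟨W, κ, fun q => ρ q / areaDensity f ν q, fun q => (-T q / S q) • a + η q, hC.isOpen,
    hC.mem, hC.subset, hC.smooth_curvature, ?_, hC.not_isBoundedNear hD hf, ⟨?_, ?_, ?_⟩, ?_⟩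
  · rintro q ⟨hq, hqW⟩
    have h0 := (hC.mem_regularSet_iff hqW).1 hq
    exact ⟨hC.mul_eq q hqW h0, hC.add_eq q hqW h0⟩
  · exact ((hC.smooth_coeff'.neg.div hC.smooth_coeff hC.coeff_ne_zero).smul contDiffOn_const).add
      hC.smooth_null
  · intro q hq h0
    apply hC.det_ne_zero q hq
    have : planeDet a ((-T q / S q) • a + η q) = planeDet a (η q) := by simp [planeDet]; ring
    rw [← this, h0]
    simp [planeDet]
  · rintro q ⟨hq, hqW⟩
    have h0 := (hC.mem_regularSet_iff hqW).1 hq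
    have hS := hC.coeff_ne_zero q hqW
    rw [hC.principal_iff q hqW h0 (-T q / S q) 1 _ (by rw [one_smul])]
    field_simp
    ring
  · simp [hC.coeff'_eq_zero, h]

/-- Uniqueness of the data: `κ₁` is continuous at `p` while `ρ / λ` blows up, so at regular points
near `p` the function `κ₁` must be `κ`, and density of regular points extends this. -/
theorem fderiv_eq_zero_of_isSubparabolic (hD : IsOpen D) (hf : IsFront D f ν)
    (hC : IsCurvatureData D f ν p W a η κ ρ S T) (h : IsSubparabolic D f ν p) :
    fderiv ℝ κ p (η p) = 0 := by
  obtain ⟨U, κ₁, κ₁', V, hUo, hpU, hUD, sκ₁, hpc, -, hV, hVp⟩ := h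
  have hW := hC.isOpen.mem_nhds hC.mem
  have hU := hUo.mem_nhds hpU
  have e1 : ∀ᶠ q in 𝓝 p, |κ₁ q| < |κ₁ p| + 1 :=
    (sκ₁.contDiffAt hU).continuousAt.abs.eventually_lt_const (by linarith)
  have e2 := hC.eventually_mul_lt hD hf hC.mem hC.density_eq_zero
    (hC.smooth_factor.contDiffAt hW).continuousAt (hC.factor_ne_zero p hC.mem) (|κ₁ p| + 1)
  have e3 : ∀ᶠ q in 𝓝 p, q ∈ U ∧ q ∈ W ∧
      (areaDensity f ν q ≠ 0 → κ₁ q = κ q ∧ κ₁' q = ρ q / areaDensity f ν q) := by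
    filter_upwards [e1, e2, hU, hW] with q hq1 hq2 hqU hqW
    refine ⟨hqU, hqW, fun h0 => ?_⟩
    obtain ⟨m1, m2⟩ := hpc q ⟨(hC.mem_regularSet_iff hqW).2 h0, hqU⟩
    rw [← hC.mul_eq q hqW h0] at m1
    rw [← hC.add_eq q hqW h0] at m2
    have m3 : (κ₁ q - κ q) * (κ₁ q - ρ q / areaDensity f ν q) = 0 := by
      linear_combination κ₁ q * m2 - m1
    rcases mul_eq_zero.1 m3 with m4 | m4
    · exact ⟨by linarith, by linarith⟩
    · exfalso
      have m5 : κ₁ q * areaDensity f ν q = ρ q := by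
        rw [sub_eq_zero.1 m4]; field_simp
      rw [← m5, abs_mul] at hq2
      have := lt_of_mul_lt_mul_right hq2 (abs_nonneg _)
      linarith
  obtain ⟨O, hO, hOo, hpO⟩ := eventually_nhds_iff.1 e3
  have heq : ∀ q ∈ O, κ₁ q = κ q := by
    intro q hq
    obtain ⟨hqU, hqW, -⟩ := hO q hq
    refine sub_eq_zero.1 (eq_zero_of_frequently (F := fun x => κ₁ x - κ x)
      ((sκ₁.contDiffAt (hUo.mem_nhds hqU)).continuousAt.sub
        (hC.smooth_curvature.contDiffAt (hC.isOpen.mem_nhds hqW)).continuousAt) ?_)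
    refine ((hC.frequently_density_ne_zero hqW).and_eventually (hOo.mem_nhds hq)).mono ?_
    rintro x ⟨hx0, hxO⟩
    exact sub_eq_zero.2 ((hO x hxO).2.2 hx0).1
  have hfd : fderiv ℝ κ₁ p = fderiv ℝ κ p := by
    apply Filter.EventuallyEq.fderiv_eq
    filter_upwards [hOo.mem_nhds hpO] with q hq using heq q hq
  have cV : ContinuousAt V p := (hV.smooth.contDiffAt hU).continuousAt
  have cη : ContinuousAt η p := (hC.smooth_null.contDiffAt hW).continuousAt
  -- By Cramer's rule this is the principal vector equation for `V` at regular points, with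
  -- denominators cleared; it passes to the limit `p`, where `T` vanishes and `S` does not.
  have hpar : planeDet (V p) (η p) * S p + planeDet a (V p) * T p = 0 := by
    have cS := (hC.smooth_coeff.contDiffAt hW).continuousAt
    have cT := (hC.smooth_coeff'.contDiffAt hW).continuousAt
    refine eq_zero_of_frequently
      (F := fun q => planeDet (V q) (η q) * S q + planeDet a (V q) * T q)
      (by unfold planeDet; fun_prop) ?_
    refine ((hC.frequently_density_ne_zero hC.mem).and_eventually (hOo.mem_nhds hpO)).mono ?_
    rintro x ⟨hx0, hxO⟩
    obtain ⟨hxU, hxW, hx⟩ := hO x hxO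
    have hd := hC.det_ne_zero x hxW
    have hpr := hV.principal x ⟨(hC.mem_regularSet_iff hxW).2 hx0, hxU⟩
    rw [(hx hx0).2, hC.principal_iff x hxW hx0 (planeDet (V x) (η x) / planeDet a (η x))
      (planeDet a (V x) / planeDet a (η x)) (V x)] at hpr
    · field_simp at hpr
      simpa using hpr
    · rw [div_eq_inv_mul, div_eq_inv_mul, mul_smul, mul_smul, ← smul_add, ← planeDet_smul_eq,
        inv_smul_smul₀ hd]
  rw [hC.coeff'_eq_zero, mul_zero, add_zero] at hpar
  have hpar' := (mul_eq_zero.1 hpar).resolve_right (hC.coeff_ne_zero p hC.mem)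
  rw [hfd] at hVp
  exact map_eq_zero_of_planeDet (hV.ne_zero p hpU) hVp hpar'

theorem isSubparabolic_iff (hD : IsOpen D) (hf : IsFront D f ν)
    (hC : IsCurvatureData D f ν p W a η κ ρ S T) :
    IsSubparabolic D f ν p ↔ fderiv ℝ κ p (η p) = 0 :=
  ⟨hC.fderiv_eq_zero_of_isSubparabolic hD hf, hC.isSubparabolic hD hf⟩

/-! ### The null direction relative to the singular curve. -/

theorem null_ne_zero (hC : IsCurvatureData D f ν p W a η κ ρ S T) : η p ≠ 0 := by
  intro h
  exact hC.det_ne_zero p hC.mem (by simp [h, planeDet])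

/-- At a point of the second kind the null direction is tangent to the singular set. -/
theorem fderiv_density_null_of_secondKind (hD : IsOpen D) (hf : IsFront D f ν)
    (hC : IsCurvatureData D f ν p W a η κ ρ S T) (h : IsOfSecondKind D f ν p) :
    fderiv ℝ (areaDensity f ν) p (η p) = 0 := by
  obtain ⟨hp, ε, γ, U, η', hγ, hη', hdep⟩ := h
  have h0 : (0 : ℝ) ∈ Ioo (-ε) ε := ⟨by linarith [hγ.pos], hγ.pos⟩
  have hI : Ioo (-ε) ε ∈ 𝓝 (0 : ℝ) := isOpen_Ioo.mem_nhds h0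
  have hγd : HasDerivAt γ (deriv γ 0) 0 :=
    ((hγ.smooth.contDiffAt hI).differentiableAt (by simp)).hasDerivAt
  have hl : HasFDerivAt (areaDensity f ν) (fderiv ℝ (areaDensity f ν) p) (γ 0) := by
    rw [hγ.start]
    exact ((hC.contDiffAt_density hD hf hC.mem).differentiableAt (by simp)).hasFDerivAt
  have hz : fderiv ℝ (areaDensity f ν) p (deriv γ 0) = 0 := by
    have h1 := hl.comp_hasDerivAt (0 : ℝ) hγd
    have h2 : areaDensity f ν ∘ γ =ᶠ[𝓝 0] fun _ => (0 : ℝ) := by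
      filter_upwards [hI] with t ht using hγ.density_eq_zero t ht
    exact h1.unique ((hasDerivAt_const (0 : ℝ) (0 : ℝ)).congr_of_eventuallyEq h2)
  have hdet : planeDet (deriv γ 0) (η' p) = 0 := by
    by_contra hne
    apply hdep
    rw [LinearIndependent.pair_iff]
    intro s t hst
    have c1 : s * (deriv γ 0).1 + t * (η' p).1 = 0 := by simpa using congrArg Prod.fst hst
    have c2 : s * (deriv γ 0).2 + t * (η' p).2 = 0 := by simpa using congrArg Prod.snd hst
    constructor
    · apply (mul_eq_zero.1 (_ : s * planeDet (deriv γ 0) (η' p) = 0)).resolve_right hne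
      rw [planeDet]; linear_combination (η' p).2 * c1 - (η' p).1 * c2
    · apply (mul_eq_zero.1 (_ : t * planeDet (deriv γ 0) (η' p) = 0)).resolve_right hne
      rw [planeDet]; linear_combination (deriv γ 0).1 * c2 - (deriv γ 0).2 * c1
  have hη'p : fderiv ℝ f p (η' p) = 0 := hη'.null p ⟨hp.1, hη'.mem⟩
  -- The kernel of `dλ` passes from the velocity of `γ` to the parallel `η' p`, then to `η p`, as
  -- the kernel of `df` at `p` is a line.
  exact map_eq_zero_of_planeDet (hη'.ne_zero p hη'.mem)
    (map_eq_zero_of_planeDet (hγ.regular 0 h0) hz hdet)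
    (hf.planeDet_eq_zero hD hp hη'p hC.null)

theorem hasDerivAt_standardCuspidalEdge (t : ℝ) :
    HasDerivAt (fun s : ℝ => standardCuspidalEdge (t, s)) 0 0 := by
  have h : HasDerivAt (fun s : ℝ => ![t, s ^ 2, s ^ 3]) (0 : Fin 3 → ℝ) 0 := by
    rw [hasDerivAt_pi]
    intro i
    fin_cases i
    · exact hasDerivAt_const (0 : ℝ) t
    · simpa using hasDerivAt_pow 2 (0 : ℝ)
    · simpa using hasDerivAt_pow 3 (0 : ℝ)
  have h2 := ((PiLp.continuousLinearEquiv 2 ℝ fun _ : Fin 3 => ℝ).symm.hasFDerivAt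
    (x := ![t, (0 : ℝ) ^ 2, (0 : ℝ) ^ 3])).comp_hasDerivAt (0 : ℝ) h
  rw [map_zero] at h2
  exact h2

/-- At a cuspidal edge the null direction is transversal to the singular set. -/
theorem fderiv_density_null_of_cuspidalEdge (hD : IsOpen D) (hf : IsFront D f ν)
    (hp : IsNondegenerateSingular D f ν p)
    (hC : IsCurvatureData D f ν p W a η κ ρ S T) (h : IsCuspidalEdge f p) :
    fderiv ℝ (areaDensity f ν) p (η p) ≠ 0 := by
  intro hη0
  obtain ⟨φ, Φ, hpφ, hφp, sφ, sφ', hfΦ, hΦf, sΦ, sΦ', heq⟩ := h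
  have h0t : (0 : Plane) ∈ φ.target := hφp ▸ φ.map_source hpφ
  have hφ0 : φ.symm 0 = p := by rw [← hφp, φ.left_inv hpφ]
  have dφ' : ∀ z ∈ φ.target, DifferentiableAt ℝ φ.symm z := fun z hz =>
    (sφ'.contDiffAt (φ.open_target.mem_nhds hz)).differentiableAt (by simp)
  have dφ : ∀ z ∈ φ.source, DifferentiableAt ℝ φ z := fun z hz =>
    (sφ.contDiffAt (φ.open_source.mem_nhds hz)).differentiableAt (by simp)
  have inv1 : ∀ z ∈ φ.target, ∀ X, fderiv ℝ φ (φ.symm z) (fderiv ℝ φ.symm z X) = X := by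
    intro z hz X
    have h1 := (dφ _ (φ.map_target hz)).hasFDerivAt.comp z (dφ' z hz).hasFDerivAt
    have h2 : φ ∘ φ.symm =ᶠ[𝓝 z] id := by
      filter_upwards [φ.open_target.mem_nhds hz] with w hw using φ.right_inv hw
    have h3 := h1.unique ((hasFDerivAt_id z).congr_of_eventuallyEq h2)
    exact congrArg (fun A : Plane →L[ℝ] Plane => A X) h3
  have inv2 : ∀ X, fderiv ℝ φ.symm 0 (fderiv ℝ φ p X) = X := by
    intro X
    have h0 : HasFDerivAt φ.symm (fderiv ℝ φ.symm 0) (φ p) := by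
      rw [hφp]; exact (dφ' 0 h0t).hasFDerivAt
    have h1 := h0.comp p (dφ p hpφ).hasFDerivAt
    have h2 : φ.symm ∘ φ =ᶠ[𝓝 p] id := by
      filter_upwards [φ.open_source.mem_nhds hpφ] with w hw using φ.left_inv hw
    have h3 := h1.unique ((hasFDerivAt_id p).congr_of_eventuallyEq h2)
    exact congrArg (fun A : Plane →L[ℝ] Plane => A X) h3
  have cφ' : Tendsto φ.symm (𝓝 0) (𝓝 p) := by
    have := (dφ' 0 h0t).continuousAt.tendsto
    rwa [hφ0] at this
  have cf : ContinuousAt f p :=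
    (hf.smooth.contDiffAt (hD.mem_nhds hp.1.1)).continuousAt
  have ev1 : ∀ᶠ z in 𝓝 (0 : Plane), z ∈ φ.target ∧ φ.symm z ∈ W ∧
      f (φ.symm z) ∈ Φ.source ∧ Φ (f (φ.symm z)) = standardCuspidalEdge z := by
    filter_upwards [φ.open_target.mem_nhds h0t, cφ' (hC.isOpen.mem_nhds hC.mem),
      cφ' (cf (Φ.open_source.mem_nhds hfΦ)), cφ' heq] with z hz hzW hzΦ hze
    refine ⟨hz, hzW, hzΦ, ?_⟩
    have hze' : Φ (f (φ.symm z)) = standardCuspidalEdge (φ (φ.symm z)) := hze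
    rwa [φ.right_inv hz] at hze'
  obtain ⟨O, hO, hOo, h0O⟩ := eventually_nhds_iff.1 ev1
  -- The model has zero `v`-derivative along `v = 0`, so the transported `v`-direction is null for
  -- `f`.
  have hnull : ∀ t : ℝ, ((t, 0) : Plane) ∈ O →
      fderiv ℝ f (φ.symm (t, 0)) (fderiv ℝ φ.symm (t, 0) (0, 1)) = 0 := by
    intro t ht
    obtain ⟨hz, hzW, hzΦ, hze⟩ := hO _ ht
    have hline : HasDerivAt (fun s : ℝ => ((t, s) : Plane)) (0, 1) 0 :=
      (hasDerivAt_const (0 : ℝ) t).prodMk (hasDerivAt_id (0 : ℝ))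
    have d1 : HasDerivAt (fun s : ℝ => φ.symm ((t, s) : Plane))
        (fderiv ℝ φ.symm (t, 0) (0, 1)) 0 :=
      HasFDerivAt.comp_hasDerivAt (f := fun s : ℝ => ((t, s) : Plane)) (0 : ℝ)
        (dφ' (t, 0) hz).hasFDerivAt hline
    have df : DifferentiableAt ℝ f (φ.symm (t, 0)) :=
      (hf.smooth.contDiffAt (hD.mem_nhds (hC.subset hzW))).differentiableAt (by simp)
    have d2 := HasFDerivAt.comp_hasDerivAt (f := fun s : ℝ => φ.symm ((t, s) : Plane)) (0 : ℝ)
      df.hasFDerivAt d1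
    have hgt : standardCuspidalEdge (t, 0) ∈ Φ.target := hze ▸ Φ.map_source hzΦ
    have dΦ : DifferentiableAt ℝ Φ.symm (standardCuspidalEdge (t, 0)) :=
      (sΦ'.contDiffAt (Φ.open_target.mem_nhds hgt)).differentiableAt (by simp)
    have d3 := HasFDerivAt.comp_hasDerivAt (f := fun s : ℝ => standardCuspidalEdge (t, s)) (0 : ℝ)
      dΦ.hasFDerivAt (hasDerivAt_standardCuspidalEdge t)
    rw [map_zero] at d3
    refine d2.unique (d3.congr_of_eventuallyEq ?_)
    have hev : ∀ᶠ s in 𝓝 (0 : ℝ), ((t, s) : Plane) ∈ O :=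
      hline.continuousAt (hOo.mem_nhds ht)
    filter_upwards [hev] with s hs
    obtain ⟨-, -, hsΦ, hse⟩ := hO _ hs
    change f (φ.symm (t, s)) = Φ.symm (standardCuspidalEdge (t, s))
    rw [← hse, Φ.left_inv hsΦ]
  have hne : ∀ z ∈ φ.target, fderiv ℝ φ.symm z (0, 1) ≠ 0 := by
    intro z hz h0
    have := inv1 z hz (0, 1)
    rw [h0, map_zero] at this
    simpa using congrArg Prod.snd this
  have hdens : ∀ t : ℝ, ((t, 0) : Plane) ∈ O → areaDensity f ν (φ.symm (t, 0)) = 0 := by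
    intro t ht
    obtain ⟨hz, hzW, -, -⟩ := hO _ ht
    by_contra h0
    apply hne _ hz
    apply (hC.injective_iff _ hzW).2 h0
    rw [hnull t ht, map_zero]
  have hl : HasFDerivAt (areaDensity f ν) (fderiv ℝ (areaDensity f ν) p) (φ.symm 0) := by
    rw [hφ0]
    exact ((hC.contDiffAt_density hD hf hC.mem).differentiableAt (by simp)).hasFDerivAt
  -- `dλ` kills the image of the `u`-direction, because `λ` vanishes along the image of `v = 0`, and
  -- by assumption that of the `v`-direction, which is parallel to `η p`. Together these force `dλ =
  -- 0` at `p`, a contradiction.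
  have t1 : fderiv ℝ (areaDensity f ν) p (fderiv ℝ φ.symm 0 (1, 0)) = 0 := by
    have hline : HasDerivAt (fun t : ℝ => ((t, 0) : Plane)) (1, 0) 0 :=
      (hasDerivAt_id (0 : ℝ)).prodMk (hasDerivAt_const (0 : ℝ) (0 : ℝ))
    have d1 := HasFDerivAt.comp_hasDerivAt (f := fun t : ℝ => ((t, 0) : Plane)) (0 : ℝ)
      (hl.comp (0 : Plane) (dφ' 0 h0t).hasFDerivAt) hline
    refine d1.unique ((hasDerivAt_const (0 : ℝ) (0 : ℝ)).congr_of_eventuallyEq ?_)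
    have hev : ∀ᶠ t in 𝓝 (0 : ℝ), ((t, 0) : Plane) ∈ O :=
      hline.continuousAt (hOo.mem_nhds h0O)
    filter_upwards [hev] with t ht using hdens t ht
  have t2 : fderiv ℝ (areaDensity f ν) p (fderiv ℝ φ.symm 0 (0, 1)) = 0 := by
    refine map_eq_zero_of_planeDet hC.null_ne_zero hη0
      (hf.planeDet_eq_zero hD hp hC.null ?_)
    have := hnull 0 h0O
    change fderiv ℝ f (φ.symm 0) (fderiv ℝ φ.symm 0 (0, 1)) = 0 at this
    rwa [hφ0] at this
  apply hC.fderiv_density_ne_zero p hC.mem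
  refine ContinuousLinearMap.ext fun X => ?_
  set Y := fderiv ℝ φ p X with hY
  have hYe : Y = Y.1 • ((1, 0) : Plane) + Y.2 • ((0, 1) : Plane) := by ext <;> simp
  rw [← inv2 X, ← hY, hYe, map_add, map_smul, map_smul, map_add, map_smul, map_smul, t1, t2]
  simp

end IsCurvatureData

end

end FrontGeometry

theorem proposition3p4 (D : Set Plane) (hD : IsOpen D) (hDconn : IsConnected D)
    (f ν : Plane → Space) (hf : IsFront D f ν)
    (p : Plane) (hp : IsNondegenerateSingular D f ν p)
    (hK : IsBoundedNear D f p (gaussCurvature f ν)) :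
    (IsCuspidalEdge f p →
      ∃ Kp : ℝ, Tendsto (gaussCurvature f ν) (𝓝[regularSet D f] p) (𝓝 Kp) ∧
        (IsSubparabolic D f ν p ↔ Kp = 0)) ∧
    (IsOfSecondKind D f ν p → IsSubparabolic D f ν p) := by
  obtain ⟨W, a, η, κ, ρ, S, T, hC⟩ := exists_isCurvatureData hD hf hp
  obtain ⟨c, hc, hlim⟩ := hC.exists_tendsto_gaussCurvature hD hf hK
  rw [hC.isSubparabolic_iff hD hf, hc, smul_apply, smul_eq_mul]
  constructor
  · intro h
    refine ⟨c * ρ p, hlim, ?_⟩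
    rw [mul_eq_zero, mul_eq_zero, or_iff_left (hC.factor_ne_zero p hC.mem),
      or_iff_left (hC.fderiv_density_null_of_cuspidalEdge hD hf hp h)]
  · intro h
    rw [hC.fderiv_density_null_of_secondKind hD hf h, mul_zero]
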